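/- Let $M$ be a compact complex manifold of dimension $m$ with complex structure $J$, and let $(L,h)\to M$ be a holomorphic line bundle with a smooth Hermitian metric whose curvature form $\omega=-i\,\partial\bar\partial\log h$ is positive, so that $\omega$ is a Kähler form. Let $H:M\to\mathbb R$ be smooth, with Hamiltonian vector field $\xi_H$ defined by $dH(Y)=\omega(\xi_H,Y)$. For $k=1,2,\dots$ let $H^0(M,L^k)$ be the space of holomorphic sections of $L^k$ with the $L^2$ inner product given by $h^k$ and the volume form $\omega^m/m!$, let $\Pi_k$ be the orthogonal projection onto $H^0(M,L^k)$, and let $$\hat H_k=\Pi_k\circ\Bigl(H+\tfrac{i}{k}\nabla_{\xi_H}\Bigr)\circ\Pi_k : H^0(M,L^k)\to H^0(M,L^k),$$ where $\nabla$ is the Chern connection of $(L^k,h^k)$. Let $(s_{k,j})_j$ be any orthonormal basis of $H^0(M,L^k)$ consisting of eigensections of $\hat H_k$, with eigenvalues $\mu_{k,j}\in\mathbb R$. For $z\in M$ and $I\subset\mathbb R$ put $$\mu_k^z=\sum_j\|s_{k,j}(z)\|^2_{h^k}\,\delta_{\mu_{k,j}},\qquad \Pi_k(z)=\sum_j\|s_{k,j}(z)\|^2_{h^k},\qquad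 \Pi_{k,I}(z)=\sum_{\mu_{k,j}\in I}\|s_{k,j}(z)\|^2_{h^k},$$ and, when $\Pi_k(z)\neq0$, let $\hat\mu_k^z=\mu_k^z(\mathbb R)^{-1}\mu_k^z$ be the normalized pointwise spectral measure. Assume that $H$ generates a holomorphic Hamiltonian $\mathbb R$-action, i.e. that the flow of $\xi_H$ is a smooth action of $\mathbb R$ on $M$ by holomorphic maps. Let $z_c$ be a critical point of $H$ and $E=H(z_c)$. Then: 1. For every $k\ge1$, $\mu_k^{z_c}=\Pi_k(z_c)\,\delta_E$; hence $\hat\mu_k^{z_c}=\delta_E$ for every $k\geq 1$ with $\Pi_k(z_c)\ne0$. 2. For every $k\ge1$ and every $I\subset\mathbb R$ (in particular every interval), $\Pi_{k,I}(z_c)=\Pi_k(z_c)$ if $E\in I$, and $\Pi_{k,I}(z_c)=0$ if $E\notin I$. Consequently, as $k\to\infty$ through the integers with $\Pi_k(z_c)\neq0$, for which the quotient is defined, $$\frac{\Pi_{k,I}(z_c)}{\Pi_k(z_c)}\longrightarrow\begin{cases}1,&E\in I,\\0,&E\notin I.\end{cases}$$ -/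

import Mathlib

open scoped Manifold ContDiff Topology TensorProduct ENNReal
open Bundle MeasureTheory Filter

noncomputable section

namespace KahlerQuantization

variable {m : ℕ} {M : Type*} [TopologicalSpace M] [ChartedSpace (Fin m → ℂ) M]
  {L : M → Type*} [TopologicalSpace (TotalSpace ℂ L)]
  [∀ x, AddCommGroup (L x)] [∀ x, Module ℂ (L x)] [∀ x, TopologicalSpace (L x)]
  [FiberBundle ℂ L] [VectorBundle ℂ ℂ L]

/-! ### Hermitian line bundles, their tensor powers and holomorphic sections -/

variable (m L) in
/-- A smooth Hermitian metric on the complex line bundle `L` (linear in the first variable,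
conjugate-linear in the second one). -/
structure HermitianMetric where
  inner : ∀ x : M, L x →ₗ[ℂ] L x →ₛₗ[starRingEnd ℂ] ℂ
  conj_symm : ∀ (x : M) (v w : L x), inner x v w = starRingEnd ℂ (inner x w v)
  pos : ∀ (x : M) (v : L x), v ≠ 0 → 0 < (inner x v v).re
  smooth : ∀ p : M, ContMDiffOn 𝓘(ℝ, Fin m → ℂ) 𝓘(ℝ, ℝ) ∞
    (fun x => (inner x ((trivializationAt ℂ L p).symm x 1)
      ((trivializationAt ℂ L p).symm x 1)).re)
    (trivializationAt ℂ L p).baseSet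

variable (L) in
/-- Set-theoretic sections of the tensor power `L ^ k`, whose fibre at `x` is `(L x)^{⊗ k}`. -/
abbrev PowSection (k : ℕ) := ∀ x : M, ⨂[ℂ]^k (L x)

/-- The local coordinate on `(L x)^{⊗ k}` induced by the local trivialization `e` of `L`:
the linear form with `v₁ ⊗ ⋯ ⊗ v_k ↦ e(v₁) ⋯ e(v_k)`. -/
def powCoord (k : ℕ) (e : Trivialization ℂ (π ℂ L)) [e.IsLinear ℂ] (x : M) :
    ⨂[ℂ]^k (L x) →ₗ[ℂ] ℂ :=
  PiTensorProduct.lift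
    ((MultilinearMap.mkPiAlgebra ℂ (Fin k) ℂ).compLinearMap fun _ => e.linearMapAt ℂ x)

variable (m L) in
/-- `H⁰(M, L ^ k)`: the space of holomorphic sections of `L ^ k`. -/
def holSections (k : ℕ) : Submodule ℂ (PowSection L k) where
  carrier := {s | ∀ p : M, MDifferentiableOn 𝓘(ℂ, Fin m → ℂ) 𝓘(ℂ, ℂ)
    (fun x => powCoord k (trivializationAt ℂ L p) x (s x)) (trivializationAt ℂ L p).baseSet}
  zero_mem' := fun p => by
    simpa using mdifferentiableOn_const
  add_mem' := fun {s t} hs ht p => by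
    simpa [Pi.add_def] using (hs p).add (ht p)
  smul_mem' := fun c s hs p => by
    simpa [Pi.smul_def] using (hs p).const_smul c

/-! ### The Kähler geometry of `(M, L, h)` -/

/-- `h(e, e)`, where `e` is the local frame of `L` given by a local trivialization. -/
def frameNormSq (h : HermitianMetric m L) (e : Trivialization ℂ (π ℂ L)) (x : M) : ℝ :=
  (h.inner x (e.symm x 1) (e.symm x 1)).re

/-- The local Kähler potential `φ = - log h(e, e)`. -/
def potential (h : HermitianMetric m L) (e : Trivialization ℂ (π ℂ L)) (x : M) : ℝ :=
  -Real.log (frameNormSq h e x)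

/-- The second real derivative `D²φ(u, v)` of the local Kähler potential in the chart `c`, at the
point with coordinates `y`. -/
def potentialHess (h : HermitianMetric m L) (c : OpenPartialHomeomorph M (Fin m → ℂ))
    (e : Trivialization ℂ (π ℂ L)) (y u v : Fin m → ℂ) : ℝ :=
  fderiv ℝ (fderiv ℝ (fun z => potential h e (c.symm z))) y u v

/-- The complex structure `J` on the tangent spaces of `M` (multiplication by `i` in a holomorphic
chart). -/
def complexJ (x : M) (v : TangentSpace 𝓘(ℝ, Fin m → ℂ) x) : TangentSpace 𝓘(ℝ, Fin m → ℂ) x :=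
  HSMul.hSMul (α := ℂ) (β := Fin m → ℂ) (γ := Fin m → ℂ) Complex.I v

/-- The Kähler form `ω = - i ∂∂̄ log h = i ∂∂̄ φ` on the tangent space at `x`; it is the form
`ω(u, v) = (D²φ(iu, v) - D²φ(u, iv)) / 2` in a holomorphic chart. -/
def kahlerForm (h : HermitianMetric m L) (x : M) (u v : TangentSpace 𝓘(ℝ, Fin m → ℂ) x) : ℝ :=
  let D := potentialHess h (chartAt (Fin m → ℂ) x) (trivializationAt ℂ L x)
    (chartAt (Fin m → ℂ) x x)
  (D (complexJ x u) v - D u (complexJ x v)) / 2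

/-- The Kähler metric `g(u, v) = ω(u, J v)`. -/
def kahlerMetric (h : HermitianMetric m L) (x : M) (u v : TangentSpace 𝓘(ℝ, Fin m → ℂ) x) : ℝ :=
  kahlerForm h x u (complexJ x v)

/-- `(L, h)` is positive: `ω` is a Kähler form. -/
def IsPositive (h : HermitianMetric m L) : Prop :=
  ∀ (x : M) (v : TangentSpace 𝓘(ℝ, Fin m → ℂ) x), v ≠ 0 → 0 < kahlerMetric h x v v

/-- The matrix `∂²φ / ∂z_j ∂z̄_l` of the local potential in the chart `c`, at coordinates `y`. -/
def leviMatrix (h : HermitianMetric m L) (c : OpenPartialHomeomorph M (Fin m → ℂ))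
    (e : Trivialization ℂ (π ℂ L)) (y : Fin m → ℂ) : Matrix (Fin m) (Fin m) ℂ :=
  Matrix.of fun j l =>
    let D := potentialHess h c e y
    let a : Fin m → ℂ := Pi.single j 1
    let b : Fin m → ℂ := Pi.single l 1
    (((D a b + D (Complex.I • a) (Complex.I • b)) / 4 : ℝ) : ℂ) +
      Complex.I * (((D a (Complex.I • b) - D (Complex.I • a) b) / 4 : ℝ) : ℂ)

/-- The density of `ω ^ m / m!` with respect to Lebesgue measure in the chart `c`, which is
`2 ^ m det (∂²φ / ∂z_j ∂z̄_l)`. -/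
def volumeDensity (h : HermitianMetric m L) (c : OpenPartialHomeomorph M (Fin m → ℂ))
    (y : Fin m → ℂ) : ℝ :=
  2 ^ m * (leviMatrix h c (trivializationAt ℂ L (c.symm y)) y).det.re

variable (m M) in
theorem exists_partitionOfUnity [CompactSpace M] [T2Space M] :
    ∃ ρ : PartitionOfUnity M M, ρ.IsSubordinate fun p => (chartAt (Fin m → ℂ) p).source :=
  PartitionOfUnity.exists_isSubordinate isClosed_univ _
    (fun p => (chartAt (Fin m → ℂ) p).open_source)
    (fun p _ => Set.mem_iUnion.2 ⟨p, mem_chart_source _ p⟩)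

/-- The volume measure of `ω ^ m / m!`, glued from its expressions in the charts by means of a
partition of unity (the result does not depend on the partition). -/
def kahlerVolume [CompactSpace M] [T2Space M] [MeasurableSpace M] (h : HermitianMetric m L) :
    Measure M :=
  let ρ := (exists_partitionOfUnity m M).choose
  Measure.sum fun p : M =>
    let c := chartAt (Fin m → ℂ) p
    (((volume : Measure (Fin m → ℂ)).restrict c.target).withDensity
      fun y => ENNReal.ofReal (ρ p (c.symm y) * volumeDensity h c y)).map c.symm

/-! ### The Chern connection, the Hilbert space `L²(M, L ^ k)` and the Bergman projection -/

/-- The pointwise inner product induced by `h ^ k` on `(L x)^{⊗ k}`. -/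
def powInner (h : HermitianMetric m L) (k : ℕ) (x : M) (a b : ⨂[ℂ]^k (L x)) : ℂ :=
  let e := trivializationAt ℂ L x
  powCoord k e x a * starRingEnd ℂ (powCoord k e x b) * ((frameNormSq h e x ^ k : ℝ) : ℂ)

/-- The squared pointwise norm of a section of `L ^ k`. -/
def normSqAt (h : HermitianMetric m L) (k : ℕ) (s : PowSection L k) (x : M) : ℝ :=
  (powInner h k x (s x) (s x)).re

/-- The `L²` inner product of sections of `L ^ k`. -/
def l2Inner [CompactSpace M] [T2Space M] [MeasurableSpace M] (h : HermitianMetric m L) (k : ℕ)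
    (s t : PowSection L k) : ℂ :=
  ∫ x, powInner h k x (s x) (t x) ∂(kahlerVolume h)

/-- The Chern connection one-form `∂ log h(e, e) = - ∂φ` of `L` in the local frame of the
trivialization `e`, evaluated on a real tangent vector `v`; here `∂φ(v) = (dφ(v) - i dφ(J v)) / 2`. -/
def chernForm (h : HermitianMetric m L) (e : Trivialization ℂ (π ℂ L)) (x : M)
    (v : TangentSpace 𝓘(ℝ, Fin m → ℂ) x) : ℂ :=
  let dφ : TangentSpace 𝓘(ℝ, Fin m → ℂ) x → ℝ :=
    fun w => mfderiv 𝓘(ℝ, Fin m → ℂ) 𝓘(ℝ, ℝ) (potential h e) x w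
  (Complex.I * ((dφ (complexJ x v) : ℝ) : ℂ) - ((dφ v : ℝ) : ℂ)) / 2

/-- The covariant derivative `∇_ξ s` for the Chern connection of `(L ^ k, h ^ k)`:
if `s = f e^{⊗ k}`, then `∇_ξ s = (ξ f + k f ∂ log h(e, e)(ξ)) e^{⊗ k}`. -/
def chernDeriv (h : HermitianMetric m L) (k : ℕ)
    (ξ : ∀ x : M, TangentSpace 𝓘(ℝ, Fin m → ℂ) x) (s : PowSection L k) : PowSection L k :=
  fun x =>
    let e := trivializationAt ℂ L x
    let f : M → ℂ := fun y => powCoord k e y (s y)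
    let df : TangentSpace 𝓘(ℝ, Fin m → ℂ) x → ℂ :=
      fun w => mfderiv 𝓘(ℝ, Fin m → ℂ) 𝓘(ℝ, ℂ) f x w
    (df (ξ x) + (k : ℂ) * f x * chernForm h e x (ξ x)) •
      PiTensorProduct.tprod ℂ (fun _ : Fin k => e.symm x 1)

open Classical in
/-- The orthogonal projection `Π_k` onto `H⁰(M, L ^ k)`: `Π_k u` is the holomorphic section `v`
such that `u - v` is `L²`-orthogonal to all holomorphic sections. -/
def bergmanProj [CompactSpace M] [T2Space M] [MeasurableSpace M] (h : HermitianMetric m L) (k : ℕ)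
    (u : PowSection L k) : PowSection L k :=
  if hu : ∃ v ∈ holSections m L k, ∀ t ∈ holSections m L k, l2Inner h k u t = l2Inner h k v t
  then hu.choose else 0

/-! ### Hamiltonians and their quantization -/

open Classical in
/-- The Hamiltonian vector field `ξ_H` of `H`, determined by `dH(Y) = ω(ξ_H, Y)` for all `Y`. -/
def hamiltonianField (h : HermitianMetric m L) (H : M → ℝ) (x : M) :
    TangentSpace 𝓘(ℝ, Fin m → ℂ) x :=
  if hx : ∃ ξ : TangentSpace 𝓘(ℝ, Fin m → ℂ) x, ∀ v : TangentSpace 𝓘(ℝ, Fin m → ℂ) x,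
    mfderiv 𝓘(ℝ, Fin m → ℂ) 𝓘(ℝ, ℝ) H x v = kahlerForm h x ξ v
  then hx.choose else 0

/-- `H` generates a holomorphic Hamiltonian `ℝ`-action: the flow of `ξ_H` is a smooth action of
`ℝ` on `M` by holomorphic maps. -/
def GeneratesHolomorphicAction (h : HermitianMetric m L) (H : M → ℝ) : Prop :=
  ∃ φ : Flow ℝ M,
    ContMDiff (𝓘(ℝ, ℝ).prod 𝓘(ℝ, Fin m → ℂ)) 𝓘(ℝ, Fin m → ℂ) ∞ (fun q : ℝ × M => φ q.1 q.2) ∧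
    (∀ t : ℝ, MDifferentiable 𝓘(ℂ, Fin m → ℂ) 𝓘(ℂ, Fin m → ℂ) (φ t)) ∧
    ∀ x : M, IsMIntegralCurve (I := 𝓘(ℝ, Fin m → ℂ)) (fun t : ℝ => φ t x) (hamiltonianField h H)

/-- The Berezin–Toeplitz quantization `Ĥ_k = Π_k ∘ (H + (i / k) ∇_{ξ_H})` on `H⁰(M, L ^ k)`. -/
def toeplitz [CompactSpace M] [T2Space M] [MeasurableSpace M] (h : HermitianMetric m L)
    (H : M → ℝ) (k : ℕ) (s : PowSection L k) : PowSection L k :=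
  bergmanProj h k fun x =>
    (H x : ℂ) • s x + (Complex.I / (k : ℂ)) • chernDeriv h k (hamiltonianField h H) s x

/-- An `L²`-orthonormal basis `s_{k,1}, …, s_{k,N}` of `H⁰(M, L ^ k)` which consists of
eigensections of `Ĥ_k`, with the eigenvalues `μ_{k,1}, …, μ_{k,N}` (repeated according to
multiplicity, in any order). -/
structure EigenBasis [CompactSpace M] [T2Space M] [MeasurableSpace M] (h : HermitianMetric m L)
    (H : M → ℝ) (k : ℕ) where
  N : ℕ
  sec : Fin N → PowSection L k
  eigenvalue : Fin N → ℝ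
  orthonormal : ∀ i j, l2Inner h k (sec i) (sec j) = if i = j then 1 else 0
  span_eq : Submodule.span ℂ (Set.range sec) = holSections m L k
  eigen : ∀ j, toeplitz h H k (sec j) = (eigenvalue j : ℂ) • sec j

variable [CompactSpace M] [T2Space M] [MeasurableSpace M]

/-- The Bergman density `Π_k(z) = ∑_j ‖s_{k,j}(z)‖²`. -/
def EigenBasis.density {h : HermitianMetric m L} {H : M → ℝ} {k : ℕ} (B : EigenBasis h H k)
    (z : M) : ℝ :=
  ∑ j, normSqAt h k (B.sec j) z

open Classical in
/-- The partial Bergman density `Π_{k,I}(z) = ∑_{μ_{k,j} ∈ I} ‖s_{k,j}(z)‖²`. -/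
def EigenBasis.partialDensity {h : HermitianMetric m L} {H : M → ℝ} {k : ℕ}
    (B : EigenBasis h H k) (I : Set ℝ) (z : M) : ℝ :=
  ∑ j with B.eigenvalue j ∈ I, normSqAt h k (B.sec j) z

/-- The pointwise spectral measure `μ_k^z = ∑_j ‖s_{k,j}(z)‖² δ_{μ_{k,j}}`. -/
def EigenBasis.spectralMeasure {h : HermitianMetric m L} {H : M → ℝ} {k : ℕ}
    (B : EigenBasis h H k) (z : M) : Measure ℝ :=
  ∑ j, ENNReal.ofReal (normSqAt h k (B.sec j) z) • Measure.dirac (B.eigenvalue j)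

/-- The normalized pointwise spectral measure `μ_k^z(ℝ)⁻¹ μ_k^z`. -/
def EigenBasis.normalizedSpectralMeasure {h : HermitianMetric m L} {H : M → ℝ} {k : ℕ}
    (B : EigenBasis h H k) (z : M) : Measure ℝ :=
  (B.spectralMeasure z Set.univ)⁻¹ • B.spectralMeasure z

end KahlerQuantization

end

/-! Write P = H + (i/k)∇_ξ with ξ = ξ_H. Because the flow of ξ is holomorphic, P maps holomorphic
sections to holomorphic sections (`prequantum_mem_holSections`), so the projection in Ĥ_k acts
trivially and an eigensection satisfies P s = μ s pointwise. At a critical point ξ vanishes, since ω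
is nondegenerate (`hamiltonianField_eq_zero`), and the equation there reads H(z_c) s(z_c) = μ
s(z_c). Hence s(z_c) = 0 unless μ = E (`normSqAt_sec_eq_zero`), and both assertions follow by
summing over the basis.

For the holomorphy of P s, let s = f e^k in a local frame with potential φ, and let W be ξ in a
chart. The coordinate of P s is (H - i∂φ(W)) f + (i/k) df(W). The field W is holomorphic as the
velocity of holomorphic maps (`differentiableAt_velocity`). Then df(W) is holomorphic because
partial derivatives of f are, and H - i∂φ(W) is holomorphic because dH = ω(ξ, ·) says exactly that
∂̄H = i∂̄(∂φ(W)) (`differentiableAt_hamiltonian_sub_potential`). The definitions use the frame and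
the chart at each point, so the formula must first be moved to one fixed frame and chart
(`powCoord_chernDeriv`). -/

namespace KahlerQuantization

/-! ### Holomorphic functions of several variables -/

section SeveralVariables

variable {E : Type*} [NormedAddCommGroup E] [NormedSpace ℂ E]

/-- Cauchy's formula for the derivative on the complex line through y in direction w. The circle and
the kernel do not depend on y, so the right side can be differentiated in y under the integral sign.
-/
theorem fderiv_apply_eq_circleIntegral {f : E → ℂ} {U : Set E} (hU : IsOpen U)
    (hf : DifferentiableOn ℂ f U) {y w : E} {r : ℝ} (hr : 0 < r)
    (hy : ∀ ζ ∈ Metric.closedBall (0 : ℂ) r, y + ζ • w ∈ U) :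
    fderiv ℂ f y w = (2 * Real.pi * Complex.I : ℂ)⁻¹ • ∫ θ in (0 : ℝ)..2 * Real.pi,
      (deriv (circleMap 0 r) θ * ((circleMap 0 r θ - 0) ^ 2)⁻¹) • f (y + circleMap 0 r θ • w) := by
  have hline : Differentiable ℂ fun ζ : ℂ => y + ζ • w := by fun_prop
  have hd : DifferentiableOn ℂ (fun ζ : ℂ => f (y + ζ • w)) ((fun ζ : ℂ => y + ζ • w) ⁻¹' U) :=
    hf.comp hline.differentiableOn (Set.mapsTo_preimage _ _)
  have key := Complex.two_pi_I_inv_smul_circleIntegral_sub_sq_inv_smul_of_differentiable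
    (hU.preimage hline.continuous) (fun ζ hζ => hy ζ hζ) hd (Metric.mem_ball_self hr)
  have h0 : HasDerivAt (fun ζ : ℂ => f (y + ζ • w)) (fderiv ℂ f y w) 0 := by
    have hl : HasDerivAt (fun ζ : ℂ => y + ζ • w) w 0 := by
      simpa using ((hasDerivAt_id (0 : ℂ)).smul_const w).const_add y
    have hfy : HasFDerivAt f (fderiv ℂ f y) (y + (0 : ℂ) • w) := by
      have : y ∈ U := by simpa using hy 0 (Metric.mem_closedBall_self hr.le)
      simpa using (hf.differentiableAt (hU.mem_nhds this)).hasFDerivAt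
    exact hfy.comp_hasDerivAt (0 : ℂ) hl
  rw [← h0.deriv, ← key, circleIntegral]
  simp only [smul_smul]

/-- Directional derivatives of a holomorphic function of several variables are holomorphic. -/
theorem differentiableAt_fderiv_apply [FiniteDimensional ℂ E] {f : E → ℂ} {y₀ : E}
    (hf : ∀ᶠ y in 𝓝 y₀, DifferentiableAt ℂ f y) (w : E) :
    DifferentiableAt ℂ (fun y => fderiv ℂ f y w) y₀ := by
  have hcont : ∀ᶠ y in 𝓝 y₀, f y ∈ Metric.ball (f y₀) 1 :=
    hf.self_of_nhds.continuousAt.eventually (Metric.ball_mem_nhds _ one_pos)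
  obtain ⟨R', hR'0, hR'⟩ := Metric.eventually_nhds_iff_ball.1 (hf.and hcont)
  -- Room for three moves of size R: y moves by R, the circle adds another R, and the Cauchy
  -- estimate needs a ball of radius R around the result.
  obtain ⟨R, hR, rfl⟩ : ∃ R, 0 < R ∧ R' = 4 * R := ⟨R' / 4, by positivity, by ring⟩
  have hdiff : DifferentiableOn ℂ f (Metric.ball y₀ (4 * R)) :=
    fun y hy => (hR' y hy).1.differentiableWithinAt
  -- Cauchy estimate: all values of f lie within 1 of f y₀, hence within 2 of f z.
  have hbound : ∀ z ∈ Metric.ball y₀ (2 * R), ‖fderiv ℂ f z‖ ≤ 2 / R := by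
    intro z hz
    have hsub : Metric.ball z R ⊆ Metric.ball y₀ (4 * R) := by
      apply Metric.ball_subset_ball'
      rw [Metric.mem_ball] at hz
      linarith
    refine Complex.norm_fderiv_le_div_of_mapsTo_ball (hdiff.mono hsub) (fun u hu => ?_) hR
    have h1 := (hR' u (hsub hu)).2
    have h2 := (hR' z (hsub (Metric.mem_ball_self hR))).2
    rw [Metric.mem_ball] at h1 h2
    rw [Metric.mem_closedBall]
    linarith [dist_triangle_right (f u) (f z) (f y₀)]
  obtain ⟨r, hr, hrw⟩ : ∃ r : ℝ, 0 < r ∧ r * ‖w‖ < R := by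
    refine ⟨R / (‖w‖ + 1), by positivity, ?_⟩
    rw [div_mul_eq_mul_div, div_lt_iff₀ (by positivity)]
    nlinarith [norm_nonneg w]
  have hmem : ∀ y ∈ Metric.ball y₀ R, ∀ ζ ∈ Metric.closedBall (0 : ℂ) r,
      y + ζ • w ∈ Metric.ball y₀ (2 * R) := by
    intro y hy ζ hζ
    rw [mem_ball_iff_norm] at hy ⊢
    rw [mem_closedBall_zero_iff] at hζ
    have h1 : ‖ζ • w‖ ≤ r * ‖w‖ := by rw [norm_smul]; gcongr
    calc ‖y + ζ • w - y₀‖ = ‖(y - y₀) + ζ • w‖ := by congr 1; abel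
      _ ≤ ‖y - y₀‖ + ‖ζ • w‖ := norm_add_le _ _
      _ < 2 * R := by linarith
  have hsub : Metric.ball y₀ (2 * R) ⊆ Metric.ball y₀ (4 * R) :=
    Metric.ball_subset_ball (by linarith)
  have hcirc : ∀ θ : ℝ, circleMap 0 r θ ∈ Metric.closedBall (0 : ℂ) r := fun θ =>
    circleMap_mem_closedBall 0 hr.le θ
  set K : ℝ → ℂ := fun θ => deriv (circleMap 0 r) θ * ((circleMap 0 r θ - 0) ^ 2)⁻¹ with hK
  have hKc : Continuous K := by
    have h1 : ∀ θ, (circleMap 0 r θ - 0) ^ 2 ≠ 0 := fun θ => by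
      simpa using hr.ne'
    simp only [hK, deriv_circleMap]
    exact ((continuous_circleMap 0 r).mul continuous_const).mul
      ((((continuous_circleMap 0 r).sub continuous_const).pow 2).inv₀ h1)
  have hline : ∀ y : E, Continuous fun θ : ℝ => y + circleMap 0 r θ • w := fun y =>
    continuous_const.add ((continuous_circleMap 0 r).smul continuous_const)
  have hFc : ∀ y ∈ Metric.ball y₀ R, Continuous fun θ => K θ • f (y + circleMap 0 r θ • w) := by
    intro y hy
    refine hKc.smul (continuous_iff_continuousAt.2 fun θ => ?_)
    exact ContinuousAt.comp (f := fun θ : ℝ => y + circleMap 0 r θ • w)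
      (hR' _ (hsub (hmem y hy _ (hcirc θ)))).1.continuousAt (hline y).continuousAt
  have key : HasFDerivAt (fun y => ∫ θ in (0 : ℝ)..2 * Real.pi, K θ • f (y + circleMap 0 r θ • w))
      (∫ θ in (0 : ℝ)..2 * Real.pi, K θ • fderiv ℂ f (y₀ + circleMap 0 r θ • w)) y₀ := by
    refine intervalIntegral.hasFDerivAt_integral_of_dominated_of_fderiv_le
      (F := fun y θ => K θ • f (y + circleMap 0 r θ • w))
      (F' := fun y θ => K θ • fderiv ℂ f (y + circleMap 0 r θ • w))
      (bound := fun θ => ‖K θ‖ * (2 / R)) (Metric.ball_mem_nhds y₀ hR) ?_ ?_ ?_ ?_ ?_ ?_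
    · filter_upwards [Metric.ball_mem_nhds y₀ hR] with y hy
      exact (hFc y hy).aestronglyMeasurable
    · exact (hFc y₀ (Metric.mem_ball_self hR)).intervalIntegrable _ _
    -- Continuity of the derivative is not yet known; measurability of `fderiv` suffices here.
    · borelize E
      have : FiniteDimensional ℂ (E →L[ℂ] ℂ) := inferInstance
      have : SecondCountableTopology (E →L[ℂ] ℂ) := by
        have := FiniteDimensional.proper ℂ (E →L[ℂ] ℂ)
        infer_instance
      have hm : Measurable (fderiv ℂ f) := measurable_fderiv ℂ f
      exact hKc.aestronglyMeasurable.smul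
        (hm.comp (hline y₀).measurable).aestronglyMeasurable
    · refine Eventually.of_forall fun θ _ y hy => ?_
      rw [norm_smul]
      exact mul_le_mul_of_nonneg_left (hbound _ (hmem y hy _ (hcirc θ))) (norm_nonneg _)
    · exact (hKc.norm.mul continuous_const).intervalIntegrable _ _
    · refine Eventually.of_forall fun θ _ y hy => ?_
      have h1 : HasFDerivAt f (fderiv ℂ f (y + circleMap 0 r θ • w)) (y + circleMap 0 r θ • w) :=
        (hR' _ (hsub (hmem y hy _ (hcirc θ)))).1.hasFDerivAt
      have h2 : HasFDerivAt (fun y : E => y + circleMap 0 r θ • w) (ContinuousLinearMap.id ℂ E) y :=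
        (hasFDerivAt_id y).add_const _
      have h3 := (h1.comp y h2).const_smul (K θ)
      rw [ContinuousLinearMap.comp_id] at h3
      exact h3
  have hev : (fun y => fderiv ℂ f y w) =ᶠ[𝓝 y₀] fun y => (2 * Real.pi * Complex.I : ℂ)⁻¹ •
      ∫ θ in (0 : ℝ)..2 * Real.pi, K θ • f (y + circleMap 0 r θ • w) := by
    filter_upwards [Metric.ball_mem_nhds y₀ hR] with y hy
    exact fderiv_apply_eq_circleIntegral Metric.isOpen_ball hdiff hr
      fun ζ hζ => hsub (hmem y hy ζ hζ)
  exact DifferentiableAt.congr_of_eventuallyEq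
    (key.differentiableAt.const_smul (2 * Real.pi * Complex.I : ℂ)⁻¹) hev

variable {F : Type*} [NormedAddCommGroup F] [NormedSpace ℂ F]

/-- Cauchy–Riemann: a real-linear derivative that commutes with i is complex linear. -/
theorem differentiableAt_complex_of_real {f : E → F} {x : E} {f' : E →L[ℝ] F}
    (hf : HasFDerivAt f f' x) (hI : ∀ v, f' (Complex.I • v) = Complex.I • f' v) :
    DifferentiableAt ℂ f x := by
  refine (differentiableAt_iff_restrictScalars ℝ hf.differentiableAt).2
    ⟨{ toFun := f', map_add' := map_add f', map_smul' := fun c v => ?_, cont := f'.cont }, ?_⟩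
  · have hc : c • v = c.re • v + c.im • (Complex.I • v) := by
      rw [← Complex.coe_smul c.re, ← Complex.coe_smul c.im, smul_smul, ← add_smul,
        Complex.re_add_im]
    have hc' : c • f' v = c.re • f' v + c.im • (Complex.I • f' v) := by
      rw [← Complex.coe_smul c.re, ← Complex.coe_smul c.im, smul_smul, ← add_smul,
        Complex.re_add_im]
    simp only [RingHom.id_apply]
    rw [hc, map_add, map_smul, map_smul, hI, hc']
  · rw [hf.fderiv]
    rfl

/-- The velocity at time zero of a smooth family of holomorphic maps is holomorphic. -/
theorem differentiableAt_velocity {Γ : ℝ × E → F} {y₀ : E}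
    (hΓ : ContDiffAt ℝ 2 Γ (0, y₀))
    (hhol : ∀ᶠ q in 𝓝 ((0 : ℝ), y₀), DifferentiableAt ℂ (fun y => Γ (q.1, y)) q.2) :
    DifferentiableAt ℂ (fun y => fderiv ℝ Γ (0, y) (1, 0)) y₀ := by
  have hD : DifferentiableAt ℝ (fderiv ℝ Γ) (0, y₀) :=
    (hΓ.fderiv_right (m := 1) le_rfl).differentiableAt one_ne_zero
  set D2 := fderiv ℝ (fderiv ℝ Γ) (0, y₀) with hD2
  have hsymm : ∀ u w, D2 u w = D2 w u := hΓ.isSymmSndFDerivAt (by simp)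
  have hΓd : ∀ᶠ q in 𝓝 ((0 : ℝ), y₀), DifferentiableAt ℝ Γ q :=
    (hΓ.eventually (by simp)).mono fun q hq => hq.differentiableAt two_ne_zero
  have hinr : ∀ q : ℝ × E, HasFDerivAt (fun y : E => ((q.1, y) : ℝ × E))
      (ContinuousLinearMap.inr ℝ ℝ E) q.2 := fun q => hasFDerivAt_prodMk_right q.1 q.2
  have hlin : ∀ᶠ q in 𝓝 ((0 : ℝ), y₀), ∀ v : E,
      fderiv ℝ Γ q (0, Complex.I • v) = Complex.I • fderiv ℝ Γ q (0, v) := by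
    filter_upwards [hhol, hΓd] with q hq hq' v
    have h1 : HasFDerivAt (fun y => Γ (q.1, y))
        ((fderiv ℝ Γ q).comp (ContinuousLinearMap.inr ℝ ℝ E)) q.2 :=
      HasFDerivAt.comp (g := Γ) q.2 (by simpa using hq'.hasFDerivAt) (hinr q)
    have h2 := (hq.hasFDerivAt.restrictScalars ℝ).unique h1
    have h3 : ∀ u, fderiv ℝ Γ q (0, u) = fderiv ℂ (fun y => Γ (q.1, y)) q.2 u := fun u => by
      simpa using (DFunLike.congr_fun h2 u).symm
    rw [h3, h3, map_smul]
  have hd1 : ∀ v : E, HasDerivAt (fun t : ℝ => fderiv ℝ Γ (t, y₀) (0, v)) (D2 (1, 0) (0, v)) 0 := by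
    intro v
    have hl : HasDerivAt (fun t : ℝ => ((t, y₀) : ℝ × E)) (1, 0) 0 :=
      (hasDerivAt_id (0 : ℝ)).prodMk (hasDerivAt_const (0 : ℝ) y₀)
    have h1 : HasDerivAt (fun t : ℝ => fderiv ℝ Γ (t, y₀)) (D2 (1, 0)) 0 :=
      HasFDerivAt.comp_hasDerivAt (l := fderiv ℝ Γ) (0 : ℝ) hD.hasFDerivAt hl
    simpa using h1.clm_apply (hasDerivAt_const (0 : ℝ) ((0, v) : ℝ × E))
  have hd2 : HasFDerivAt (fun y => fderiv ℝ Γ (0, y) (1, 0))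
      ((ContinuousLinearMap.apply ℝ F ((1, 0) : ℝ × E)).comp
        (D2.comp (ContinuousLinearMap.inr ℝ ℝ E))) y₀ := by
    have h1 : HasFDerivAt (fun y => fderiv ℝ Γ (0, y)) (D2.comp (ContinuousLinearMap.inr ℝ ℝ E)) y₀ :=
      HasFDerivAt.comp (g := fderiv ℝ Γ) y₀ hD.hasFDerivAt (hinr (0, y₀))
    exact (ContinuousLinearMap.apply ℝ F ((1, 0) : ℝ × E)).hasFDerivAt.comp y₀ h1
  refine differentiableAt_complex_of_real hd2 fun v => ?_
  -- The Cauchy–Riemann identity holds at every small time, so it may be differentiated in t;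
  -- symmetry of the second derivative then turns it into the identity for the velocity.
  have hgoal : D2 (1, 0) (0, Complex.I • v) = Complex.I • D2 (1, 0) (0, v) := by
    have hev : (fun t : ℝ => fderiv ℝ Γ (t, y₀) (0, Complex.I • v)) =ᶠ[𝓝 0]
        fun t : ℝ => Complex.I • fderiv ℝ Γ (t, y₀) (0, v) := by
      have ht : Tendsto (fun t : ℝ => ((t, y₀) : ℝ × E)) (𝓝 0) (𝓝 (0, y₀)) :=
        Continuous.tendsto' (by fun_prop) _ _ rfl
      exact (ht.eventually hlin).mono fun t ht => ht v
    exact (hd1 (Complex.I • v)).unique (((hd1 v).const_smul Complex.I).congr_of_eventuallyEq hev)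
  rw [hsymm, hsymm (1, 0)] at hgoal
  exact hgoal

end SeveralVariables

/-! ### Frames of the line bundle and their transition functions -/

section Frames

variable {m : ℕ} {M : Type*} [TopologicalSpace M] [ChartedSpace (Fin m → ℂ) M]
  {L : M → Type*} [TopologicalSpace (TotalSpace ℂ L)]
  [∀ x, AddCommGroup (L x)] [∀ x, Module ℂ (L x)] [∀ x, TopologicalSpace (L x)]
  [FiberBundle ℂ L] [VectorBundle ℂ ℂ L]

/-- The transition function `g` between two frames of a line bundle: `e = g e'`. -/
noncomputable def transition (e e' : Trivialization ℂ (π ℂ L)) [e.IsLinear ℂ] [e'.IsLinear ℂ]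
    (x : M) : ℂ :=
  e'.linearMapAt ℂ x (e.symm x 1)

variable (e e' : Trivialization ℂ (π ℂ L)) [e.IsLinear ℂ] [e'.IsLinear ℂ] {x : M}

theorem linearMapAt_eq_transition_mul (hx : x ∈ e.baseSet) (v : L x) :
    e'.linearMapAt ℂ x v = transition e e' x * e.linearMapAt ℂ x v := by
  have hv : v = e.linearMapAt ℂ x v • e.symm x 1 := by
    have h1 : e.symmₗ ℂ x (e.linearMapAt ℂ x v) = v := e.symmₗ_linearMapAt hx v
    have h2 : e.symmₗ ℂ x (e.linearMapAt ℂ x v • (1 : ℂ)) =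
        e.linearMapAt ℂ x v • e.symmₗ ℂ x 1 := map_smul _ _ _
    rwa [smul_eq_mul, mul_one, h1, e.coe_symmₗ hx] at h2
  conv_lhs => rw [hv]
  rw [map_smul, smul_eq_mul, mul_comm]
  rfl

theorem symm_one_eq_transition_smul (hx' : x ∈ e'.baseSet) :
    e.symm x 1 = transition e e' x • e'.symm x 1 := by
  have h1 : e'.symmₗ ℂ x (e'.linearMapAt ℂ x (e.symm x 1)) = e.symm x 1 :=
    e'.symmₗ_linearMapAt hx' _
  have h2 : e'.symmₗ ℂ x (transition e e' x • (1 : ℂ)) = transition e e' x • e'.symmₗ ℂ x 1 :=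
    map_smul _ _ _
  rwa [smul_eq_mul, mul_one, transition, h1, e'.coe_symmₗ hx'] at h2

theorem linearMapAt_symm_one (hx : x ∈ e.baseSet) : e.linearMapAt ℂ x (e.symm x 1) = 1 := by
  have h1 := e.linearMapAt_symmₗ (R := ℂ) hx 1
  rwa [e.coe_symmₗ hx] at h1

theorem transition_ne_zero (hx : x ∈ e.baseSet) (hx' : x ∈ e'.baseSet) :
    transition e e' x ≠ 0 := by
  intro h0
  have h1 := symm_one_eq_transition_smul e e' hx'
  rw [h0, zero_smul] at h1
  have h2 := linearMapAt_symm_one e hx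
  rw [h1, map_zero] at h2
  exact zero_ne_one h2

theorem powCoord_eq_transition_pow_mul (k : ℕ) (hx : x ∈ e.baseSet) (a : ⨂[ℂ]^k (L x)) :
    powCoord k e' x a = transition e e' x ^ k * powCoord k e x a := by
  have : powCoord k e' x = transition e e' x ^ k • powCoord k e x := by
    refine PiTensorProduct.ext (MultilinearMap.ext fun v => ?_)
    simp only [powCoord, LinearMap.compMultilinearMap_apply, PiTensorProduct.lift.tprod,
      LinearMap.smul_apply, MultilinearMap.compLinearMap_apply, MultilinearMap.mkPiAlgebra_apply,
      smul_eq_mul, linearMapAt_eq_transition_mul e e' hx, Finset.prod_mul_distrib]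
    simp
  rw [this]
  rfl

theorem powCoord_tprod_symm_one (k : ℕ) (hx : x ∈ e.baseSet) :
    powCoord k e x (PiTensorProduct.tprod ℂ fun _ : Fin k => e.symm x 1) = 1 := by
  simp only [powCoord, PiTensorProduct.lift.tprod, MultilinearMap.compLinearMap_apply,
    MultilinearMap.mkPiAlgebra_apply, linearMapAt_symm_one e hx, Finset.prod_const_one]

variable (h : HermitianMetric m L)

theorem frameNormSq_eq_transition (hx' : x ∈ e'.baseSet) :
    frameNormSq h e x = ‖transition e e' x‖ ^ 2 * frameNormSq h e' x := by
  have h1 : (h.inner x (e.symm x 1)) (e.symm x 1) = ((‖transition e e' x‖ ^ 2 : ℝ) : ℂ) *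
      (h.inner x (e'.symm x 1)) (e'.symm x 1) := by
    rw [symm_one_eq_transition_smul e e' hx', (h.inner x).map_smul, LinearMap.smul_apply,
      LinearMap.map_smulₛₗ, smul_eq_mul, smul_eq_mul, ← mul_assoc, Complex.mul_conj,
      Complex.normSq_eq_norm_sq]
  rw [frameNormSq, h1, Complex.re_ofReal_mul]
  rfl

theorem frameNormSq_pos (hx : x ∈ e.baseSet) : 0 < frameNormSq h e x := by
  refine h.pos x _ fun h0 => ?_
  have h2 := linearMapAt_symm_one e hx
  rw [h0, map_zero] at h2
  exact zero_ne_one h2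

/-- The factors |g|^{2k} from the coordinates and from the frame norm cancel. Since `powInner` uses
a frame that varies with the point, this is what allows continuity to be read in a single frame. -/
theorem powInner_eq (k : ℕ) (hx : x ∈ e.baseSet) (a b : ⨂[ℂ]^k (L x)) :
    powInner h k x a b = powCoord k e x a * starRingEnd ℂ (powCoord k e x b) *
      ((frameNormSq h e x ^ k : ℝ) : ℂ) := by
  have hx' := FiberBundle.mem_baseSet_trivializationAt' (F := ℂ) (E := L) x
  have hn := frameNormSq_eq_transition e (trivializationAt ℂ L x) h hx'
  have hc : ((‖transition e (trivializationAt ℂ L x) x‖ ^ 2 : ℝ) : ℂ) =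
      transition e (trivializationAt ℂ L x) x *
        starRingEnd ℂ (transition e (trivializationAt ℂ L x) x) := by
    rw [Complex.mul_conj, Complex.normSq_eq_norm_sq]
  rw [hn, powInner, powCoord_eq_transition_pow_mul e (trivializationAt ℂ L x) k hx,
    powCoord_eq_transition_pow_mul e (trivializationAt ℂ L x) k hx, mul_pow, Complex.ofReal_mul,
    Complex.ofReal_pow (‖_‖ ^ 2), hc, map_mul, map_pow]
  ring

theorem normSqAt_nonneg (k : ℕ) (s : PowSection L k) (x : M) : 0 ≤ normSqAt h k s x := by
  have hx := FiberBundle.mem_baseSet_trivializationAt' (F := ℂ) (E := L) x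
  rw [normSqAt, powInner_eq _ h k hx, Complex.mul_conj, ← Complex.ofReal_mul, Complex.ofReal_re]
  exact mul_nonneg (Complex.normSq_nonneg _) (pow_nonneg (frameNormSq_pos _ h hx).le k)

theorem continuous_powInner {k : ℕ} {s t : PowSection L k} (hs : s ∈ holSections m L k)
    (ht : t ∈ holSections m L k) : Continuous fun x => powInner h k x (s x) (t x) := by
  refine continuous_iff_continuousAt.2 fun p => ?_
  have hp := FiberBundle.mem_baseSet_trivializationAt' (F := ℂ) (E := L) p
  have hU : (trivializationAt ℂ L p).baseSet ∈ 𝓝 p :=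
    (trivializationAt ℂ L p).open_baseSet.mem_nhds hp
  have h1 := (hs p).continuousOn.continuousAt hU
  have h2 := (ht p).continuousOn.continuousAt hU
  have h3 := (h.smooth p).continuousOn.continuousAt hU
  have h4 := (h1.mul (Complex.continuous_conj.continuousAt.comp h2)).mul
    (Complex.continuous_ofReal.continuousAt.comp (h3.pow k))
  refine h4.congr ?_
  filter_upwards [hU] with x hx
  exact (powInner_eq _ h k hx _ _).symm

end Frames

/-! ### Holomorphy of the transition functions -/

section HolomorphicFrames

variable {m : ℕ} {M : Type*} [TopologicalSpace M] [ChartedSpace (Fin m → ℂ) M]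
  {L : M → Type*} [TopologicalSpace (TotalSpace ℂ L)]
  [∀ x, AddCommGroup (L x)] [∀ x, Module ℂ (L x)] [∀ x, TopologicalSpace (L x)]
  [FiberBundle ℂ L] [VectorBundle ℂ ℂ L] [ContMDiffVectorBundle ω ℂ L 𝓘(ℂ, Fin m → ℂ)]

theorem mdifferentiableAt_transition (e e' : Trivialization ℂ (π ℂ L))
    [MemTrivializationAtlas e] [MemTrivializationAtlas e']
    {x : M} (hx : x ∈ e.baseSet) (hx' : x ∈ e'.baseSet) :
    MDifferentiableAt 𝓘(ℂ, Fin m → ℂ) 𝓘(ℂ, ℂ) (transition e e') x := by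
  have h1 : ContMDiffAt 𝓘(ℂ, Fin m → ℂ) 𝓘(ℂ, ℂ →L[ℂ] ℂ) ω
    (fun b : M => (e.coordChangeL ℂ e' b : ℂ →L[ℂ] ℂ)) x := contMDiffAt_coordChangeL hx hx'
  have h2 := (h1.clm_apply (contMDiffAt_const (c := (1 : ℂ)))).mdifferentiableAt (by simp)
  refine h2.congr_of_eventuallyEq ?_
  filter_upwards [(e.open_baseSet.inter e'.open_baseSet).mem_nhds ⟨hx, hx'⟩] with y hy
  have h3 := e.coordChangeL_apply (R := ℂ) e' hy 1
  rw [transition, Trivialization.linearMapAt_apply, if_pos hy.2]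
  exact h3.symm

end HolomorphicFrames

/-! ### Derivatives in a fixed chart -/

section ChartCalculus

variable {m : ℕ} {M : Type*} [TopologicalSpace M] [ChartedSpace (Fin m → ℂ) M]

/-- The derivative at `y` of the change of coordinates from the chart at `y` to the chart at `x`. -/
noncomputable def chartJacobian (x y : M) : (Fin m → ℂ) →L[ℂ] (Fin m → ℂ) :=
  fderiv ℂ (chartAt (Fin m → ℂ) x ∘ (chartAt (Fin m → ℂ) y).symm) (chartAt (Fin m → ℂ) y y)

theorem chartJacobian_self (x : M) : chartJacobian x x = ContinuousLinearMap.id ℂ (Fin m → ℂ) := by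
  have h1 : chartAt (Fin m → ℂ) x ∘ (chartAt (Fin m → ℂ) x).symm =ᶠ[𝓝 (chartAt (Fin m → ℂ) x x)]
      id := by
    filter_upwards [(chartAt (Fin m → ℂ) x).open_target.mem_nhds (mem_chart_target _ x)] with z hz
    exact (chartAt (Fin m → ℂ) x).right_inv hz
  rw [chartJacobian, h1.fderiv_eq, fderiv_id]

variable [IsManifold 𝓘(ℂ, Fin m → ℂ) ω M]

theorem hasFDerivAt_chartJacobian {x y : M} (hy : y ∈ (chartAt (Fin m → ℂ) x).source) :
    HasFDerivAt (chartAt (Fin m → ℂ) x ∘ (chartAt (Fin m → ℂ) y).symm) (chartJacobian x y)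
      (chartAt (Fin m → ℂ) y y) := by
  have h1 : MDifferentiableAt 𝓘(ℂ, Fin m → ℂ) 𝓘(ℂ, Fin m → ℂ) (chartAt (Fin m → ℂ) x) y :=
    mdifferentiableAt_atlas (chart_mem_atlas _ x) hy
  have h2 := ((mdifferentiableAt_iff _ _).1 h1).2
  simp only [mfld_simps, differentiableWithinAt_univ] at h2
  exact h2.hasFDerivAt

/-- `mfderiv` at y refers to the preferred chart at y, which jumps with y. To differentiate its
values in y, everything is expressed in the one chart at x, at the cost of the Jacobian. -/
theorem mfderiv_eq_fderiv_chart {V : Type*} [NormedAddCommGroup V] [NormedSpace ℝ V] {f : M → V}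
    {x y : M} (hy : y ∈ (chartAt (Fin m → ℂ) x).source)
    (hf : DifferentiableAt ℝ (fun z => f ((chartAt (Fin m → ℂ) x).symm z))
      (chartAt (Fin m → ℂ) x y)) (w : Fin m → ℂ) :
    mfderiv 𝓘(ℝ, Fin m → ℂ) 𝓘(ℝ, V) f y w =
      fderiv ℝ (fun z => f ((chartAt (Fin m → ℂ) x).symm z)) (chartAt (Fin m → ℂ) x y)
        (chartJacobian x y w) := by
  set c := chartAt (Fin m → ℂ) x with hc
  have hev : (fun p => f (c.symm (c p))) =ᶠ[𝓝 y] f := by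
    filter_upwards [c.open_source.mem_nhds hy] with p hp
    rw [c.left_inv hp]
  have hcont : ContinuousAt f y := by
    refine ContinuousAt.congr ?_ hev
    exact ContinuousAt.comp (g := fun z => f (c.symm z)) hf.continuousAt (c.continuousAt hy)
  have hyy : (chartAt (Fin m → ℂ) y).symm (chartAt (Fin m → ℂ) y y) = y :=
    (chartAt (Fin m → ℂ) y).left_inv (mem_chart_source _ y)
  have h1 : HasFDerivAt (fun z => f (c.symm (c ((chartAt (Fin m → ℂ) y).symm z))))
      ((fderiv ℝ (fun z => f (c.symm z)) (c y)).comp ((chartJacobian x y).restrictScalars ℝ))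
      (chartAt (Fin m → ℂ) y y) := by
    refine HasFDerivAt.comp (g := fun z => f (c.symm z))
      (f := c ∘ (chartAt (Fin m → ℂ) y).symm) _ ?_
      ((hasFDerivAt_chartJacobian hy).restrictScalars ℝ)
    rw [Function.comp_apply, hyy]
    exact hf.hasFDerivAt
  have h2 : HasFDerivAt (fun z => f ((chartAt (Fin m → ℂ) y).symm z))
      ((fderiv ℝ (fun z => f (c.symm z)) (c y)).comp ((chartJacobian x y).restrictScalars ℝ))
      (chartAt (Fin m → ℂ) y y) := by
    refine h1.congr_of_eventuallyEq ?_
    have ht : Tendsto (chartAt (Fin m → ℂ) y).symm (𝓝 (chartAt (Fin m → ℂ) y y)) (𝓝 y) := by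
      have := (chartAt (Fin m → ℂ) y).symm.continuousAt (mem_chart_target _ y)
      rwa [ContinuousAt, hyy] at this
    exact (ht.eventually hev).mono fun z hz => hz.symm
  have h3 : HasMFDerivAt 𝓘(ℝ, Fin m → ℂ) 𝓘(ℝ, V) f y
      ((fderiv ℝ (fun z => f (c.symm z)) (c y)).comp ((chartJacobian x y).restrictScalars ℝ)) := by
    refine ⟨hcont, ?_⟩
    simp only [mfld_simps]
    exact h2.hasFDerivWithinAt (s := Set.univ)
  rw [h3.mfderiv]
  rfl

theorem hasDerivAt_chart_of_hasMFDerivAt {γ : ℝ → M} {x y : M} (hγ0 : γ 0 = y)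
    {ξ : ∀ x : M, TangentSpace 𝓘(ℝ, Fin m → ℂ) x} (hy : y ∈ (chartAt (Fin m → ℂ) x).source)
    (hγ : HasMFDerivAt 𝓘(ℝ, ℝ) 𝓘(ℝ, Fin m → ℂ) γ 0 ((1 : ℝ →L[ℝ] ℝ).smulRight (ξ (γ 0)))) :
    HasDerivAt (fun t => chartAt (Fin m → ℂ) x (γ t)) (chartJacobian x y (ξ y)) 0 := by
  subst hγ0
  obtain ⟨hcont, hd⟩ := hγ
  simp only [mfld_simps] at hd
  have hd' : HasFDerivAt (chartAt (Fin m → ℂ) (γ 0) ∘ γ)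
      ((1 : ℝ →L[ℝ] ℝ).smulRight (M₂ := Fin m → ℂ) (ξ (γ 0))) 0 := HasFDerivWithinAt.hasFDerivAt hd univ_mem
  have h1 := HasFDerivAt.comp (g := chartAt (Fin m → ℂ) x ∘ (chartAt (Fin m → ℂ) (γ 0)).symm)
    (f := chartAt (Fin m → ℂ) (γ 0) ∘ γ) (0 : ℝ)
    ((hasFDerivAt_chartJacobian hy).restrictScalars ℝ) hd'
  have h2 : HasDerivAt ((chartAt (Fin m → ℂ) x ∘ (chartAt (Fin m → ℂ) (γ 0)).symm) ∘
      (chartAt (Fin m → ℂ) (γ 0) ∘ γ)) (chartJacobian x (γ 0) ((1 : ℝ) • ξ (γ 0))) 0 := h1.hasDerivAt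
  rw [one_smul] at h2
  refine h2.congr_of_eventuallyEq ?_
  filter_upwards [hcont.eventually ((chartAt (Fin m → ℂ) (γ 0)).open_source.mem_nhds
    (mem_chart_source _ _))] with t ht
  simp only [Function.comp_apply]
  rw [(chartAt (Fin m → ℂ) (γ 0)).left_inv ht]

theorem differentiableAt_chart_symm {V : Type*} [NormedAddCommGroup V] [NormedSpace ℂ V]
    {f : M → V} {x y : M} (hy : y ∈ (chartAt (Fin m → ℂ) x).source)
    (hf : MDifferentiableAt 𝓘(ℂ, Fin m → ℂ) 𝓘(ℂ, V) f y) :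
    DifferentiableAt ℂ (fun z => f ((chartAt (Fin m → ℂ) x).symm z))
      (chartAt (Fin m → ℂ) x y) := by
  rw [← mdifferentiableAt_iff_differentiableAt]
  refine MDifferentiableAt.comp (I' := 𝓘(ℂ, Fin m → ℂ)) (g := f) _ ?_
    (mdifferentiableAt_atlas_symm (chart_mem_atlas _ x)
      ((chartAt (Fin m → ℂ) x).map_source hy))
  rwa [(chartAt (Fin m → ℂ) x).left_inv hy]

theorem mdifferentiableAt_of_chart {V : Type*} [NormedAddCommGroup V] [NormedSpace ℂ V]
    {f : M → V} {x : M}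
    (hf : DifferentiableAt ℂ (fun z => f ((chartAt (Fin m → ℂ) x).symm z))
      (chartAt (Fin m → ℂ) x x)) :
    MDifferentiableAt 𝓘(ℂ, Fin m → ℂ) 𝓘(ℂ, V) f x := by
  have h1 := MDifferentiableAt.comp (I' := 𝓘(ℂ, Fin m → ℂ)) x
    (mdifferentiableAt_iff_differentiableAt.2 hf)
    (mdifferentiableAt_atlas (chart_mem_atlas _ x) (mem_chart_source _ x))
  refine h1.congr_of_eventuallyEq ?_
  filter_upwards [(chartAt (Fin m → ℂ) x).open_source.mem_nhds (mem_chart_source _ x)] with p hp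
  simp only [Function.comp_apply]
  rw [(chartAt (Fin m → ℂ) x).left_inv hp]

end ChartCalculus

/-! ### Local Cauchy–Riemann computations -/

section Calculus

variable {E : Type*} [NormedAddCommGroup E] [NormedSpace ℂ E]

/-- The formula d log|g|² = 2 Re(g⁻¹ dg), which governs the change of the Kähler potential under a
change of frame. -/
theorem hasFDerivAt_log_norm_sq {g : E → ℂ} {g' : E →L[ℂ] ℂ} {z : E} (hg : HasFDerivAt g g' z)
    (h0 : g z ≠ 0) :
    HasFDerivAt (fun y => Real.log (‖g y‖ ^ 2))
      (2 • Complex.reCLM.comp (((g z)⁻¹ • g').restrictScalars ℝ)) z := by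
  have h1 := (hg.restrictScalars ℝ).norm_sq.log (by positivity)
  convert h1 using 1
  ext w
  have h2 : ((g z)⁻¹ * g' w).re = (‖g z‖ ^ 2)⁻¹ * (g' w * starRingEnd ℂ (g z)).re := by
    rw [Complex.inv_def, Complex.normSq_eq_norm_sq, mul_comm _ (((‖g z‖ ^ 2)⁻¹ : ℝ) : ℂ), mul_assoc,
      Complex.re_ofReal_mul, mul_comm (g' w)]
  have h3 : inner ℝ (g z) (g' w) = (g' w * starRingEnd ℂ (g z)).re := Complex.inner _ _
  simp only [nsmul_eq_mul, _root_.smul_apply, ContinuousLinearMap.coe_comp,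
    ContinuousLinearMap.coe_restrictScalars', Function.comp_apply, Complex.reCLM_apply,
    smul_eq_mul, h2, innerSL_apply_apply, h3]
  ring

end Calculus

section LocalHolomorphy

variable {m : ℕ}

/-- Expanding W in coordinates reduces the claim to derivatives of f in constant directions. -/
theorem differentiableAt_fderiv_apply_field {f : (Fin m → ℂ) → ℂ} {W : (Fin m → ℂ) → Fin m → ℂ}
    {z₀ : Fin m → ℂ} (hf : ∀ᶠ z in 𝓝 z₀, DifferentiableAt ℂ f z) (hW : DifferentiableAt ℂ W z₀) :
    DifferentiableAt ℂ (fun z => fderiv ℝ f z (W z)) z₀ := by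
  have h1 : DifferentiableAt ℂ (fun z => ∑ i, W z i * fderiv ℂ f z (Pi.single i 1)) z₀ := by
    refine DifferentiableAt.fun_sum fun i _ => ?_
    exact (differentiableAt_pi.1 hW i).mul (differentiableAt_fderiv_apply hf _)
  refine h1.congr_of_eventuallyEq ?_
  filter_upwards [hf] with z hz
  rw [hz.fderiv_restrictScalars ℝ, ContinuousLinearMap.coe_restrictScalars']
  conv_lhs => rw [pi_eq_sum_univ' (W z)]
  rw [map_sum]
  refine Finset.sum_congr rfl fun i _ => ?_
  rw [map_smul, smul_eq_mul]

/-- In local coordinates: if `Hf` is a Hamiltonian of the holomorphic field `W` for the form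
`i ∂∂̄ φ`, then `Hf - i ∂φ(W)` satisfies the Cauchy–Riemann equations. -/
theorem differentiableAt_hamiltonian_sub_potential {Hf φ : (Fin m → ℂ) → ℝ}
    {W : (Fin m → ℂ) → Fin m → ℂ} {z₀ : Fin m → ℂ} (hH : DifferentiableAt ℝ Hf z₀)
    (hφ : ContDiffAt ℝ 2 φ z₀) (hW : DifferentiableAt ℂ W z₀)
    (hham : ∀ v : Fin m → ℂ, fderiv ℝ Hf z₀ v =
      (fderiv ℝ (fderiv ℝ φ) z₀ (Complex.I • W z₀) v -
        fderiv ℝ (fderiv ℝ φ) z₀ (W z₀) (Complex.I • v)) / 2) :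
    DifferentiableAt ℂ (fun z => (Hf z : ℂ) + Complex.I *
      ((Complex.I * ((fderiv ℝ φ z (Complex.I • W z) : ℝ) : ℂ) -
        ((fderiv ℝ φ z (W z) : ℝ) : ℂ)) / 2)) z₀ := by
  have hD : HasFDerivAt (fderiv ℝ φ) (fderiv ℝ (fderiv ℝ φ) z₀) z₀ :=
    ((hφ.fderiv_right (m := 1) le_rfl).differentiableAt one_ne_zero).hasFDerivAt
  set D2 := fderiv ℝ (fderiv ℝ φ) z₀ with hD2
  have hsymm : ∀ u w, D2 u w = D2 w u := hφ.isSymmSndFDerivAt (by simp)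
  have hWr : HasFDerivAt W ((fderiv ℂ W z₀).restrictScalars ℝ) z₀ :=
    hW.hasFDerivAt.restrictScalars ℝ
  have hIW : HasFDerivAt (fun z => Complex.I • W z)
      ((Complex.I • fderiv ℂ W z₀).restrictScalars ℝ) z₀ :=
    (hW.hasFDerivAt.const_smul Complex.I).restrictScalars ℝ
  have hofReal : ∀ {f : (Fin m → ℂ) → ℝ} {f' : (Fin m → ℂ) →L[ℝ] ℝ}, HasFDerivAt f f' z₀ →
      HasFDerivAt (fun z => (f z : ℂ)) (Complex.ofRealCLM.comp f') z₀ := fun hf =>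
    Complex.ofRealCLM.hasFDerivAt.comp z₀ hf
  have h1 := hofReal (hD.clm_apply hIW)
  have h2 := hofReal (hD.clm_apply hWr)
  have h3 := (hofReal hH.hasFDerivAt).add
    ((((h1.const_mul Complex.I).sub h2).mul_const (2⁻¹ : ℂ)).const_mul Complex.I)
  simp only [← div_eq_mul_inv] at h3
  -- With `hham` inserted, the Hessian terms collapse to -(D²φ(W, iv) + i D²φ(W, v))/2, and the
  -- remaining ones are -i∂φ(dW(v)). Both are complex linear in v.
  refine differentiableAt_complex_of_real h3 fun v => ?_
  simp only [_root_.add_apply, _root_.sub_apply, _root_.smul_apply, ContinuousLinearMap.coe_comp,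
    Function.comp_apply, Complex.ofRealCLM_apply, ContinuousLinearMap.flip_apply, smul_eq_mul,
    ContinuousLinearMap.coe_restrictScalars', hham, map_smul]
  simp only [smul_smul, Complex.I_mul_I, neg_smul, one_smul, map_neg,
    hsymm v, hsymm (Complex.I • v)]
  push_cast
  ring_nf
  simp only [Complex.I_sq, Complex.I_pow_three]
  ring

end LocalHolomorphy

theorem tendsto_chartAt_symm {m : ℕ} {M : Type*} [TopologicalSpace M]
    [ChartedSpace (Fin m → ℂ) M] {x y : M} (hy : y ∈ (chartAt (Fin m → ℂ) x).source) :
    Tendsto (chartAt (Fin m → ℂ) x).symm (𝓝 (chartAt (Fin m → ℂ) x y)) (𝓝 y) := by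
  have := (chartAt (Fin m → ℂ) x).symm.continuousAt ((chartAt (Fin m → ℂ) x).map_source hy)
  rwa [ContinuousAt, (chartAt (Fin m → ℂ) x).left_inv hy] at this

/-! ### The Chern connection in a fixed frame and chart -/

section ChernConnection

variable {m : ℕ} {M : Type*} [TopologicalSpace M] [ChartedSpace (Fin m → ℂ) M]
  {L : M → Type*} [TopologicalSpace (TotalSpace ℂ L)]
  [∀ x, AddCommGroup (L x)] [∀ x, Module ℂ (L x)] [∀ x, TopologicalSpace (L x)]
  [FiberBundle ℂ L] [VectorBundle ℂ ℂ L]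

theorem chernForm_eq (h : HermitianMetric m L) (e : Trivialization ℂ (π ℂ L)) {x : M}
    {v : TangentSpace 𝓘(ℝ, Fin m → ℂ) x} {a b : ℝ}
    (ha : mfderiv 𝓘(ℝ, Fin m → ℂ) 𝓘(ℝ, ℝ) (potential h e) x (complexJ x v) = a)
    (hb : mfderiv 𝓘(ℝ, Fin m → ℂ) 𝓘(ℝ, ℝ) (potential h e) x v = b) :
    chernForm h e x v = (Complex.I * (a : ℂ) - (b : ℂ)) / 2 := by
  subst ha hb
  rfl

variable [IsManifold 𝓘(ℂ, Fin m → ℂ) ω M] [ContMDiffVectorBundle ω ℂ L 𝓘(ℂ, Fin m → ℂ)]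

/-- The local expression `ξ f + k f ∂ log h(e, e)(ξ)` of the Chern connection is compatible with a
change of frames; here it is moved from the frame `e'` to the frame `e` and the chart at `x`. -/
theorem chernDeriv_change_frame (h : HermitianMetric m L) {k : ℕ} {s : PowSection L k}
    (e e' : Trivialization ℂ (π ℂ L)) [MemTrivializationAtlas e] [MemTrivializationAtlas e'] {x y : M}
    (hs : MDifferentiableAt 𝓘(ℂ, Fin m → ℂ) 𝓘(ℂ, ℂ) (fun p => powCoord k e' p (s p)) y)
    (hy : y ∈ (chartAt (Fin m → ℂ) x).source) (hyb : y ∈ e.baseSet) (hyb' : y ∈ e'.baseSet)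
    (hφ : DifferentiableAt ℝ (fun z => potential h e ((chartAt (Fin m → ℂ) x).symm z))
      (chartAt (Fin m → ℂ) x y)) (ξ : TangentSpace 𝓘(ℝ, Fin m → ℂ) y) {w : Fin m → ℂ}
    (hw : chartJacobian x y ξ = w) {d : ℂ}
    (hd : mfderiv 𝓘(ℝ, Fin m → ℂ) 𝓘(ℝ, ℂ) (fun p => powCoord k e' p (s p)) y ξ = d) :
    transition e' e y ^ k * (d + k * powCoord k e' y (s y) * chernForm h e' y ξ) =
      fderiv ℝ (fun z => powCoord k e ((chartAt (Fin m → ℂ) x).symm z)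
        (s ((chartAt (Fin m → ℂ) x).symm z))) (chartAt (Fin m → ℂ) x y) w +
      k * powCoord k e y (s y) *
        ((Complex.I * ((fderiv ℝ (fun z => potential h e ((chartAt (Fin m → ℂ) x).symm z))
          (chartAt (Fin m → ℂ) x y) (Complex.I • w) : ℝ) : ℂ) -
          ((fderiv ℝ (fun z => potential h e ((chartAt (Fin m → ℂ) x).symm z))
          (chartAt (Fin m → ℂ) x y) w : ℝ) : ℂ)) / 2) := by
  subst hw
  set c := chartAt (Fin m → ℂ) x with hc
  have hcy : c.symm (c y) = y := c.left_inv hy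
  have hev : ∀ᶠ z in 𝓝 (c y), c.symm z ∈ e.baseSet ∩ e'.baseSet :=
    (tendsto_chartAt_symm hy).eventually
      ((e.open_baseSet.inter e'.open_baseSet).mem_nhds ⟨hyb, hyb'⟩)
  have hgne : transition e' e y ≠ 0 := transition_ne_zero e' e hyb' hyb
  have hg := (differentiableAt_chart_symm hy
    (mdifferentiableAt_transition e' e hyb' hyb)).hasFDerivAt
  have hf := (differentiableAt_chart_symm hy
    hs).hasFDerivAt
  rw [← hc] at hf hg
  set G := fderiv ℂ (fun z => transition e' e (c.symm z)) (c y) with hG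
  set F := fderiv ℂ (fun z => powCoord k e' (c.symm z) (s (c.symm z))) (c y) with hF
  -- the coordinate of the section
  have hFx : HasFDerivAt (fun z => powCoord k e (c.symm z) (s (c.symm z)))
      ((transition e' e y ^ k • F + powCoord k e' y (s y) •
        ((k * transition e' e y ^ (k - 1) : ℂ) • G)).restrictScalars ℝ) (c y) := by
    have h1 := ((hg.pow k).mul hf).restrictScalars ℝ
    have hsy : powCoord k e' (c.symm (c y)) (s (c.symm (c y))) = powCoord k e' y (s y) :=
      congrArg (fun p => powCoord k e' p (s p)) hcy
    simp only [hsy, hcy, nsmul_eq_mul] at h1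
    refine h1.congr_of_eventuallyEq (hev.mono fun z hz => ?_)
    exact powCoord_eq_transition_pow_mul e' e k hz.2 _
  -- the potential
  have hlog : HasFDerivAt (fun z => Real.log (‖transition e' e (c.symm z)‖ ^ 2))
      (2 • Complex.reCLM.comp (((transition e' e y)⁻¹ • G).restrictScalars ℝ)) (c y) := by
    have h1 := hasFDerivAt_log_norm_sq hg (by rwa [hcy])
    rwa [hcy] at h1
  set P := fderiv ℝ (fun z => potential h e (c.symm z)) (c y) with hP
  have hφ' : HasFDerivAt (fun z => potential h e' (c.symm z))
      (P - 2 • Complex.reCLM.comp (((transition e' e y)⁻¹ • G).restrictScalars ℝ)) (c y) := by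
    refine (hφ.hasFDerivAt.sub hlog).congr_of_eventuallyEq (hev.mono fun z hz => ?_)
    have h1 : ‖transition e' e (c.symm z)‖ ^ 2 ≠ 0 := by
      have := transition_ne_zero e' e hz.2 hz.1
      positivity
    simp only [potential, Pi.sub_apply]
    rw [frameNormSq_eq_transition e' e h hz.1, Real.log_mul h1 (frameNormSq_pos e h hz.1).ne']
    ring
  have hmF : ∀ w : Fin m → ℂ, mfderiv 𝓘(ℝ, Fin m → ℂ) 𝓘(ℝ, ℂ)
      (fun p => powCoord k e' p (s p)) y w = F (chartJacobian x y w) := fun w => by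
    rw [mfderiv_eq_fderiv_chart (f := fun p => powCoord k e' p (s p)) hy
      (hf.restrictScalars ℝ).differentiableAt, (hf.restrictScalars ℝ).fderiv]
    rfl
  have hmφ : ∀ w : Fin m → ℂ, mfderiv 𝓘(ℝ, Fin m → ℂ) 𝓘(ℝ, ℝ) (potential h e') y w =
      P (chartJacobian x y w) - 2 * ((transition e' e y)⁻¹ * G (chartJacobian x y w)).re :=
      fun w => by
    rw [mfderiv_eq_fderiv_chart (f := potential h e') hy hφ'.differentiableAt, hφ'.fderiv]
    simp only [_root_.sub_apply, _root_.smul_apply, ContinuousLinearMap.coe_comp,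
      Function.comp_apply, ContinuousLinearMap.coe_restrictScalars', Complex.reCLM_apply,
      nsmul_eq_mul, smul_eq_mul, Nat.cast_ofNat]
    rfl
  have hJ : ∀ w : TangentSpace 𝓘(ℝ, Fin m → ℂ) y,
      chartJacobian x y (complexJ y w) = Complex.I • chartJacobian x y w := fun w =>
    (chartJacobian x y).map_smul Complex.I w
  -- Here ∂ log|g|² = g⁻¹ dg because g is holomorphic. This extra term cancels against the
  -- derivative of g^k in the coordinate of the section.
  have hchern : chernForm h e' y ξ =
      (Complex.I * ((P (Complex.I • chartJacobian x y ξ) : ℝ) : ℂ) -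
        ((P (chartJacobian x y ξ) : ℝ) : ℂ)) / 2 +
        (transition e' e y)⁻¹ * G (chartJacobian x y ξ) := by
    have h1 := hmφ ξ
    have h2 := hmφ (complexJ y ξ)
    rw [hJ, G.map_smul, smul_eq_mul, mul_left_comm, Complex.I_mul_re] at h2
    have h4 := Complex.re_add_im ((transition e' e y)⁻¹ * G (chartJacobian x y ξ))
    have h5 : chernForm h e' y ξ =
        (Complex.I * ((P (Complex.I • chartJacobian x y ξ) -
          2 * -((transition e' e y)⁻¹ * G (chartJacobian x y ξ)).im : ℝ) : ℂ) -
        ((P (chartJacobian x y ξ) -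
          2 * ((transition e' e y)⁻¹ * G (chartJacobian x y ξ)).re : ℝ) : ℂ)) / 2 :=
      chernForm_eq h e' h2 h1
    rw [h5]
    conv_rhs => rw [← h4]
    push_cast
    ring
  have hdF : d = F (chartJacobian x y ξ) := hd.symm.trans (hmF ξ)
  rw [hdF, powCoord_eq_transition_pow_mul e' e k hyb', hchern, hFx.fderiv]
  simp only [ContinuousLinearMap.coe_restrictScalars', _root_.add_apply, _root_.smul_apply,
    smul_eq_mul]
  -- The derivative of g^k contains the truncated exponent k - 1, so k = 0 is separate.
  rcases k with _ | k
  · simp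
  · rw [Nat.add_sub_cancel, pow_succ]
    field_simp
    ring

/-- The Chern connection in the frame and the chart at `x`, at a nearby point `y`. -/
theorem powCoord_chernDeriv (h : HermitianMetric m L) {k : ℕ} {s : PowSection L k}
    (hs : s ∈ holSections m L k) (ξ : ∀ x : M, TangentSpace 𝓘(ℝ, Fin m → ℂ) x) {x y : M}
    (hy : y ∈ (chartAt (Fin m → ℂ) x).source) (hyb : y ∈ (trivializationAt ℂ L x).baseSet)
    (hφ : DifferentiableAt ℝ
      (fun z => potential h (trivializationAt ℂ L x) ((chartAt (Fin m → ℂ) x).symm z))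
      (chartAt (Fin m → ℂ) x y)) {w : Fin m → ℂ} (hw : chartJacobian x y (ξ y) = w) :
    powCoord k (trivializationAt ℂ L x) y (chernDeriv h k ξ s y) =
      fderiv ℝ (fun z => powCoord k (trivializationAt ℂ L x) ((chartAt (Fin m → ℂ) x).symm z)
        (s ((chartAt (Fin m → ℂ) x).symm z))) (chartAt (Fin m → ℂ) x y) w +
      k * powCoord k (trivializationAt ℂ L x) y (s y) *
        ((Complex.I * ((fderiv ℝ (fun z => potential h (trivializationAt ℂ L x)
          ((chartAt (Fin m → ℂ) x).symm z)) (chartAt (Fin m → ℂ) x y) (Complex.I • w) : ℝ) : ℂ) -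
          ((fderiv ℝ (fun z => potential h (trivializationAt ℂ L x)
          ((chartAt (Fin m → ℂ) x).symm z)) (chartAt (Fin m → ℂ) x y) w : ℝ) : ℂ)) / 2) := by
  have hyb' : y ∈ (trivializationAt ℂ L y).baseSet :=
    FiberBundle.mem_baseSet_trivializationAt' (F := ℂ) (E := L) y
  rw [← chernDeriv_change_frame h (trivializationAt ℂ L x) (trivializationAt ℂ L y)
    ((hs y).mdifferentiableAt ((trivializationAt ℂ L y).open_baseSet.mem_nhds hyb'))
    hy hyb hyb' hφ (ξ y) hw rfl,
    powCoord_eq_transition_pow_mul (trivializationAt ℂ L y) (trivializationAt ℂ L x) k hyb',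
    chernDeriv, map_smul, smul_eq_mul, powCoord_tprod_symm_one _ k hyb', mul_one]

end ChernConnection

theorem contDiffAt_chart_symm {m : ℕ} {M : Type*} [TopologicalSpace M]
    [ChartedSpace (Fin m → ℂ) M] {f : M → ℝ} {x : M}
    (hf : ContMDiffAt 𝓘(ℝ, Fin m → ℂ) 𝓘(ℝ, ℝ) ∞ f x) :
    ContDiffAt ℝ ∞ (fun z => f ((chartAt (Fin m → ℂ) x).symm z)) (chartAt (Fin m → ℂ) x x) := by
  have h1 := (contMDiffAt_iff.1 hf).2
  simp only [mfld_simps] at h1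
  exact h1.contDiffAt univ_mem

/-! ### Existence and zeros of the Hamiltonian field -/

section HamiltonianField

variable {m : ℕ} {M : Type*} [TopologicalSpace M] [ChartedSpace (Fin m → ℂ) M]
  {L : M → Type*} [TopologicalSpace (TotalSpace ℂ L)]
  [∀ x, AddCommGroup (L x)] [∀ x, Module ℂ (L x)] [∀ x, TopologicalSpace (L x)]
  [FiberBundle ℂ L] [VectorBundle ℂ ℂ L] {h : HermitianMetric m L}

variable (h) in
/-- The Kähler form at `x` as a bilinear form. -/
noncomputable def kahlerBilin (x : M) : (Fin m → ℂ) →ₗ[ℝ] Module.Dual ℝ (Fin m → ℂ) :=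
  let D : (Fin m → ℂ) →L[ℝ] (Fin m → ℂ) →L[ℝ] ℝ :=
    fderiv ℝ (fderiv ℝ fun z => potential h (trivializationAt ℂ L x)
      ((chartAt (Fin m → ℂ) x).symm z)) (chartAt (Fin m → ℂ) x x)
  LinearMap.mk₂ ℝ (fun u v => (D (Complex.I • u) v - D u (Complex.I • v)) / 2)
    (fun u u' v => by simp only [smul_add, map_add, _root_.add_apply]; ring)
    (fun a u v => by simp only [smul_comm Complex.I, map_smul, _root_.smul_apply, smul_eq_mul]; ring)
    (fun u v v' => by simp only [smul_add, map_add]; ring)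
    (fun a u v => by simp only [smul_comm Complex.I, map_smul, smul_eq_mul]; ring)

/-- Positivity makes ω nondegenerate: pairing ξ with iξ gives g(ξ, ξ). An injective map to the dual
is onto, by dimension. -/
theorem exists_hamiltonian_vector (hpos : IsPositive h) (x : M)
    (α : Module.Dual ℝ (Fin m → ℂ)) : ∃ ξ, kahlerBilin h x ξ = α := by
  have hinj : Function.Injective (kahlerBilin h x) := by
    rw [injective_iff_map_eq_zero]
    intro ξ hξ
    by_contra h0
    have h1 := hpos x ξ h0
    have h2 : kahlerMetric h x ξ ξ = kahlerBilin h x ξ (Complex.I • ξ) := rfl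
    rw [h2, hξ] at h1
    exact lt_irrefl _ h1
  exact (LinearMap.injective_iff_surjective_of_finrank_eq_finrank
    Subspace.dual_finrank_eq.symm).1 hinj α

/-- Positivity rules out the default value 0 in `hamiltonianField`, so the defining equation really
holds. -/
theorem mfderiv_eq_kahlerForm_hamiltonianField (hpos : IsPositive h) (H : M → ℝ) (x : M)
    (v : TangentSpace 𝓘(ℝ, Fin m → ℂ) x) :
    mfderiv 𝓘(ℝ, Fin m → ℂ) 𝓘(ℝ, ℝ) H x v = kahlerForm h x (hamiltonianField h H x) v := by
  have hex : ∃ ξ : TangentSpace 𝓘(ℝ, Fin m → ℂ) x, ∀ v : TangentSpace 𝓘(ℝ, Fin m → ℂ) x,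
      mfderiv 𝓘(ℝ, Fin m → ℂ) 𝓘(ℝ, ℝ) H x v = kahlerForm h x ξ v := by
    let α : (Fin m → ℂ) →L[ℝ] ℝ := mfderiv 𝓘(ℝ, Fin m → ℂ) 𝓘(ℝ, ℝ) H x
    obtain ⟨ξ, hξ⟩ := exists_hamiltonian_vector hpos x α.toLinearMap
    exact ⟨ξ, fun v => (LinearMap.congr_fun hξ v).symm⟩
  rw [hamiltonianField, dif_pos hex]
  exact hex.choose_spec v

/-- One has g(ξ, ξ) = ω(ξ, Jξ) = dH(Jξ) = 0. -/
theorem hamiltonianField_eq_zero (hpos : IsPositive h) {H : M → ℝ} {x : M}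
    (hx : mfderiv 𝓘(ℝ, Fin m → ℂ) 𝓘(ℝ, ℝ) H x = 0) : hamiltonianField h H x = 0 := by
  by_contra h0
  have h1 := hpos x _ h0
  rw [kahlerMetric, ← mfderiv_eq_kahlerForm_hamiltonianField hpos, hx] at h1
  exact lt_irrefl _ h1

end HamiltonianField

/-! ### Holomorphy of the generator of a holomorphic flow -/

section Flows

variable {m : ℕ} {M : Type*} [TopologicalSpace M] [ChartedSpace (Fin m → ℂ) M]
  [IsManifold 𝓘(ℂ, Fin m → ℂ) ω M]

/-- The generator of a smooth flow of holomorphic maps is a holomorphic vector field. -/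
theorem exists_holomorphic_velocity (φ : Flow ℝ M)
    (hsmooth : ContMDiff (𝓘(ℝ, ℝ).prod 𝓘(ℝ, Fin m → ℂ)) 𝓘(ℝ, Fin m → ℂ) ∞
      (fun q : ℝ × M => φ q.1 q.2))
    (hhol : ∀ t : ℝ, MDifferentiable 𝓘(ℂ, Fin m → ℂ) 𝓘(ℂ, Fin m → ℂ) (φ t))
    {ξ : ∀ x : M, TangentSpace 𝓘(ℝ, Fin m → ℂ) x}
    (hξ : ∀ x : M, IsMIntegralCurve (I := 𝓘(ℝ, Fin m → ℂ)) (fun t : ℝ => φ t x) ξ) (x : M) :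
    ∃ W : (Fin m → ℂ) → Fin m → ℂ, DifferentiableAt ℂ W (chartAt (Fin m → ℂ) x x) ∧
      ∀ᶠ z in 𝓝 (chartAt (Fin m → ℂ) x x),
        chartJacobian x ((chartAt (Fin m → ℂ) x).symm z)
          (ξ ((chartAt (Fin m → ℂ) x).symm z)) = W z := by
  set c := chartAt (Fin m → ℂ) x with hc
  have hcx : c.symm (c x) = x := c.left_inv (mem_chart_source _ x)
  have htarget : c.target ∈ 𝓝 (c x) := c.open_target.mem_nhds (mem_chart_target _ x)
  set Γ : ℝ × (Fin m → ℂ) → Fin m → ℂ := fun q => c (φ q.1 (c.symm q.2)) with hΓdef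
  have hΓ : ContDiffAt ℝ ∞ Γ (0, c x) := by
    have h1 := (contMDiffAt_iff.1 (hsmooth ((0 : ℝ), x))).2
    simp only [mfld_simps] at h1
    have h2 := h1.contDiffAt (by simp)
    simp only [φ.map_zero_apply] at h2
    exact h2
  have hΓcont : ContinuousAt (fun q : ℝ × (Fin m → ℂ) => φ q.1 (c.symm q.2)) (0, c x) := by
    have h1 : ContinuousAt (fun q : ℝ × M => φ q.1 q.2) (0, c.symm (c x)) :=
      hsmooth.continuous.continuousAt
    have h2 : ContinuousAt (fun q : ℝ × (Fin m → ℂ) => ((q.1, c.symm q.2) : ℝ × M)) (0, c x) :=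
      continuousAt_fst.prodMk
        (ContinuousAt.comp (g := c.symm) (f := Prod.snd) (x := ((0 : ℝ), c x))
          (c.symm.continuousAt (mem_chart_target _ x)) continuousAt_snd)
    exact ContinuousAt.comp (g := fun q : ℝ × M => φ q.1 q.2)
      (f := fun q : ℝ × (Fin m → ℂ) => ((q.1, c.symm q.2) : ℝ × M)) (x := ((0 : ℝ), c x)) h1 h2
  have hhol' : ∀ᶠ q in 𝓝 ((0 : ℝ), c x), DifferentiableAt ℂ (fun y => Γ (q.1, y)) q.2 := by
    have h1 : ∀ᶠ q in 𝓝 ((0 : ℝ), c x), φ q.1 (c.symm q.2) ∈ c.source := by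
      refine hΓcont.eventually (c.open_source.mem_nhds ?_)
      simp only [hcx, φ.map_zero_apply]
      exact mem_chart_source _ x
    have h2 : ∀ᶠ q in 𝓝 ((0 : ℝ), c x), q.2 ∈ c.target :=
      continuousAt_snd.eventually htarget
    filter_upwards [h1, h2] with q hq hq2
    have h3 : MDifferentiableAt 𝓘(ℂ, Fin m → ℂ) 𝓘(ℂ, Fin m → ℂ) (fun p => c (φ q.1 p))
        (c.symm q.2) :=
      MDifferentiableAt.comp (I' := 𝓘(ℂ, Fin m → ℂ)) (g := c) (f := φ q.1) (c.symm q.2)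
        (mdifferentiableAt_atlas (chart_mem_atlas _ x) hq) (hhol q.1 _)
    have h4 := differentiableAt_chart_symm (c.map_target hq2) h3
    rw [← hc, c.right_inv hq2] at h4
    exact h4
  -- The witness is the time derivative at 0 of the flow read in the chart at x.
  refine ⟨fun z => fderiv ℝ Γ (0, z) (1, 0),
    differentiableAt_velocity (hΓ.of_le ENat.LEInfty.out) hhol', ?_⟩
  have hdiff : ∀ᶠ q in 𝓝 ((0 : ℝ), c x), DifferentiableAt ℝ Γ q :=
    ((hΓ.of_le (m := 1) ENat.LEInfty.out).eventually (by simp)).mono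
      fun q hq => hq.differentiableAt one_ne_zero
  have ht : Tendsto (fun z => ((0, z) : ℝ × (Fin m → ℂ))) (𝓝 (c x)) (𝓝 (0, c x)) :=
    Continuous.tendsto' (by fun_prop) _ _ rfl
  filter_upwards [ht.eventually hdiff, htarget] with z hz hzt
  have h1 : HasDerivAt (fun t => c (φ t (c.symm z)))
      (chartJacobian x (c.symm z) (ξ (c.symm z))) 0 := by
    have h3 := hξ (c.symm z) 0
    have h4 := hasDerivAt_chart_of_hasMFDerivAt (γ := fun t => φ t (c.symm z)) (x := x)
      (φ.map_zero_apply (c.symm z)) (c.map_target hzt) h3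
    exact h4
  have h2 : HasDerivAt (fun t : ℝ => Γ (t, z)) (fderiv ℝ Γ (0, z) (1, 0)) 0 :=
    HasFDerivAt.comp_hasDerivAt (l := Γ) (0 : ℝ) hz.hasFDerivAt
      ((hasDerivAt_id (0 : ℝ)).prodMk (hasDerivAt_const (0 : ℝ) z))
  exact h1.unique h2

end Flows

/-! ### The prequantum operator preserves holomorphic sections -/

section Prequantum

variable {m : ℕ} {M : Type*} [TopologicalSpace M] [ChartedSpace (Fin m → ℂ) M]
  [IsManifold 𝓘(ℂ, Fin m → ℂ) ω M]
  {L : M → Type*} [TopologicalSpace (TotalSpace ℂ L)]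
  [∀ x, AddCommGroup (L x)] [∀ x, Module ℂ (L x)] [∀ x, TopologicalSpace (L x)]
  [FiberBundle ℂ L] [VectorBundle ℂ ℂ L] [ContMDiffVectorBundle ω ℂ L 𝓘(ℂ, Fin m → ℂ)]

/-- The prequantum operator `H + (i / k) ∇_{ξ_H}`. -/
noncomputable def prequantum (h : HermitianMetric m L) (H : M → ℝ) (k : ℕ) (s : PowSection L k) :
    PowSection L k :=
  fun x => (H x : ℂ) • s x + (Complex.I / (k : ℂ)) • chernDeriv h k (hamiltonianField h H) s x

/-- If `H` generates a holomorphic action, its prequantum operator preserves holomorphy. -/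
theorem prequantum_mem_holSections {h : HermitianMetric m L} (hpos : IsPositive h) {H : M → ℝ}
    (hH : ContMDiff 𝓘(ℝ, Fin m → ℂ) 𝓘(ℝ, ℝ) ∞ H) (haction : GeneratesHolomorphicAction h H)
    {k : ℕ} (hk : k ≠ 0) {s : PowSection L k} (hs : s ∈ holSections m L k) :
    prequantum h H k s ∈ holSections m L k := by
  intro p x hxp
  have hxx : x ∈ (trivializationAt ℂ L x).baseSet :=
    FiberBundle.mem_baseSet_trivializationAt' (F := ℂ) (E := L) x
  have hbase : (trivializationAt ℂ L x).baseSet ∈ 𝓝 x :=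
    (trivializationAt ℂ L x).open_baseSet.mem_nhds hxx
  -- The transition function to the frame at p is holomorphic, so the frame at x, which matches the
  -- chart at x, may be used instead.
  suffices hmain : MDifferentiableAt 𝓘(ℂ, Fin m → ℂ) 𝓘(ℂ, ℂ)
      (fun y => powCoord k (trivializationAt ℂ L x) y (prequantum h H k s y)) x by
    have h1 : MDifferentiableAt 𝓘(ℂ, Fin m → ℂ) 𝓘(ℂ, ℂ)
        (fun y => transition (trivializationAt ℂ L x) (trivializationAt ℂ L p) y ^ k *
          powCoord k (trivializationAt ℂ L x) y (prequantum h H k s y)) x :=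
      ((mdifferentiableAt_transition _ _ hxx hxp).pow k).mul hmain
    refine (h1.congr_of_eventuallyEq ?_).mdifferentiableWithinAt
    filter_upwards [hbase] with y hy
    exact powCoord_eq_transition_pow_mul _ _ k hy _
  obtain ⟨φ, hsmooth, hhol, hξ⟩ := haction
  obtain ⟨W, hW, hWev⟩ := exists_holomorphic_velocity φ hsmooth hhol hξ x
  have hxc := mem_chart_source (Fin m → ℂ) x
  have hcx := (chartAt (Fin m → ℂ) x).left_inv hxc
  have hWx : W (chartAt (Fin m → ℂ) x x) = hamiltonianField h H x := by
    have h1 := hWev.self_of_nhds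
    rw [hcx, chartJacobian_self] at h1
    exact h1.symm
  have hHc := contDiffAt_chart_symm hH.contMDiffAt (x := x)
  have hφc : ContDiffAt ℝ ∞ (fun z => potential h (trivializationAt ℂ L x)
      ((chartAt (Fin m → ℂ) x).symm z)) (chartAt (Fin m → ℂ) x x) := by
    have h1 := contDiffAt_chart_symm ((h.smooth x).contMDiffAt hbase)
    refine (h1.log ?_).neg
    rw [hcx]
    exact (frameNormSq_pos _ h hxx).ne'
  have htend := tendsto_chartAt_symm hxc
  have hFev : ∀ᶠ z in 𝓝 (chartAt (Fin m → ℂ) x x), DifferentiableAt ℂ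
      (fun z => powCoord k (trivializationAt ℂ L x) ((chartAt (Fin m → ℂ) x).symm z)
        (s ((chartAt (Fin m → ℂ) x).symm z))) z := by
    filter_upwards [htend.eventually hbase,
      (chartAt (Fin m → ℂ) x).open_target.mem_nhds (mem_chart_target _ x)] with z hz hzt
    have h1 := differentiableAt_chart_symm ((chartAt (Fin m → ℂ) x).map_target hzt)
      ((hs x).mdifferentiableAt ((trivializationAt ℂ L x).open_baseSet.mem_nhds hz))
    rwa [(chartAt (Fin m → ℂ) x).right_inv hzt] at h1
  have hham : ∀ v : Fin m → ℂ, fderiv ℝ (fun z => H ((chartAt (Fin m → ℂ) x).symm z))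
      (chartAt (Fin m → ℂ) x x) v =
      (fderiv ℝ (fderiv ℝ fun z => potential h (trivializationAt ℂ L x)
        ((chartAt (Fin m → ℂ) x).symm z)) (chartAt (Fin m → ℂ) x x)
          (Complex.I • W (chartAt (Fin m → ℂ) x x)) v -
        fderiv ℝ (fderiv ℝ fun z => potential h (trivializationAt ℂ L x)
        ((chartAt (Fin m → ℂ) x).symm z)) (chartAt (Fin m → ℂ) x x)
          (W (chartAt (Fin m → ℂ) x x)) (Complex.I • v)) / 2 := by
    intro v
    have h1 := mfderiv_eq_fderiv_chart hxc (hHc.differentiableAt (by simp)) v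
    rw [chartJacobian_self] at h1
    rw [hWx]
    exact h1.symm.trans (mfderiv_eq_kahlerForm_hamiltonianField hpos H x v)
  have hCR := differentiableAt_hamiltonian_sub_potential (hHc.differentiableAt (by simp))
    (hφc.of_le ENat.LEInfty.out) hW hham
  refine mdifferentiableAt_of_chart ?_
  -- The coordinate of P s is (H - i∂φ(W)) f + (i/k) df(W): the factor k in the connection form
  -- cancels 1/k, which needs k ≠ 0.
  refine ((hCR.mul hFev.self_of_nhds).add
    ((differentiableAt_fderiv_apply_field hFev hW).const_mul (Complex.I / k))).congr_of_eventuallyEq ?_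
  have hφev : ∀ᶠ z in 𝓝 (chartAt (Fin m → ℂ) x x), DifferentiableAt ℝ
      (fun z => potential h (trivializationAt ℂ L x) ((chartAt (Fin m → ℂ) x).symm z)) z :=
    ((hφc.of_le (m := 1) ENat.LEInfty.out).eventually (by simp)).mono
      fun q hq => hq.differentiableAt one_ne_zero
  filter_upwards [hWev, hφev, htend.eventually hbase,
    (chartAt (Fin m → ℂ) x).open_target.mem_nhds (mem_chart_target _ x)] with z hWz hφz hzb hzt
  have hright := (chartAt (Fin m → ℂ) x).right_inv hzt
  have h1 := powCoord_chernDeriv h hs (hamiltonianField h H)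
    ((chartAt (Fin m → ℂ) x).map_target hzt) hzb (by rwa [hright]) hWz
  rw [hright] at h1
  have hk' : (k : ℂ) ≠ 0 := Nat.cast_ne_zero.2 hk
  simp only [prequantum, map_add, map_smul, smul_eq_mul, h1, Pi.add_apply, Pi.mul_apply]
  field_simp
  ring

end Prequantum

/-! ### The Bergman projection and eigensections at a critical point -/

section Spectrum

variable {m : ℕ} {M : Type*} [TopologicalSpace M] [ChartedSpace (Fin m → ℂ) M]
  {L : M → Type*} [TopologicalSpace (TotalSpace ℂ L)]
  [∀ x, AddCommGroup (L x)] [∀ x, Module ℂ (L x)] [∀ x, TopologicalSpace (L x)]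
  [FiberBundle ℂ L] [VectorBundle ℂ ℂ L]
  [CompactSpace M] [T2Space M] [MeasurableSpace M]
  {h : HermitianMetric m L} {H : M → ℝ} {k : ℕ} (B : EigenBasis h H k)

namespace EigenBasis

theorem sec_mem (i : Fin B.N) : B.sec i ∈ holSections m L k :=
  B.span_eq ▸ Submodule.subset_span (Set.mem_range_self i)

/-- A non-integrable function has Bochner integral 0, whereas the norm is 1. No estimate on the
volume measure is needed. -/
theorem integrable_powInner_self (i : Fin B.N) :
    Integrable (fun x => powInner h k x (B.sec i x) (B.sec i x)) (kahlerVolume h) := by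
  by_contra hi
  have h1 := B.orthonormal i i
  rw [l2Inner, integral_undef hi, if_pos rfl] at h1
  exact zero_ne_one h1

variable [BorelSpace M]

/-- Domination by the two diagonal terms, from ab ≤ a² + b²; measurability comes from continuity. -/
theorem integrable_powInner (i j : Fin B.N) :
    Integrable (fun x => powInner h k x (B.sec i x) (B.sec j x)) (kahlerVolume h) := by
  refine ((B.integrable_powInner_self i).norm.add (B.integrable_powInner_self j).norm).mono'
    (continuous_powInner h (B.sec_mem i) (B.sec_mem j)).aestronglyMeasurable
    (Eventually.of_forall fun x => ?_)
  have hx : x ∈ (trivializationAt ℂ L x).baseSet :=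
    FiberBundle.mem_baseSet_trivializationAt' (F := ℂ) (E := L) x
  simp only [Pi.add_apply, powInner_eq _ h k hx, norm_mul, RCLike.norm_conj]
  rw [← add_mul]
  refine mul_le_mul_of_nonneg_right ?_ (norm_nonneg _)
  nlinarith [sq_nonneg (‖powCoord k (trivializationAt ℂ L x) x (B.sec i x)‖ -
    ‖powCoord k (trivializationAt ℂ L x) x (B.sec j x)‖),
    sq_nonneg ‖powCoord k (trivializationAt ℂ L x) x (B.sec i x)‖,
    sq_nonneg ‖powCoord k (trivializationAt ℂ L x) x (B.sec j x)‖]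

theorem l2Inner_sum (a : Fin B.N → ℂ) (j : Fin B.N) :
    l2Inner h k (∑ i, a i • B.sec i) (B.sec j) = a j := by
  have h1 : ∀ x, powInner h k x ((∑ i, a i • B.sec i) x) (B.sec j x) =
      ∑ i, a i * powInner h k x (B.sec i x) (B.sec j x) := by
    intro x
    simp only [powInner, Finset.sum_apply, Pi.smul_apply, map_sum, map_smul, smul_eq_mul,
      Finset.sum_mul, mul_assoc]
  simp only [l2Inner, h1]
  rw [integral_finsetSum _ fun i _ => (B.integrable_powInner i j).const_mul (a i)]
  simp only [integral_const_mul]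
  have h2 : ∀ i, ∫ x, powInner h k x (B.sec i x) (B.sec j x) ∂(kahlerVolume h) =
      if i = j then 1 else 0 := fun i => B.orthonormal i j
  simp [h2]

/-- Pairing with the orthonormal basis recovers all coefficients. This uniqueness pins down the
section chosen in `bergmanProj`. -/
theorem eq_of_l2Inner_eq (B : EigenBasis h H k) {u v : PowSection L k} (hu : u ∈ holSections m L k)
    (hv : v ∈ holSections m L k)
    (huv : ∀ t ∈ holSections m L k, l2Inner h k u t = l2Inner h k v t) : u = v := by
  rw [← B.span_eq] at hu hv
  obtain ⟨a, rfl⟩ := (Submodule.mem_span_range_iff_exists_fun ℂ).1 hu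
  obtain ⟨b, rfl⟩ := (Submodule.mem_span_range_iff_exists_fun ℂ).1 hv
  have : a = b := by
    ext j
    rw [← B.l2Inner_sum a j, ← B.l2Inner_sum b j, huv _ (B.sec_mem j)]
  rw [this]

/-- The Bergman projection fixes holomorphic sections. -/
theorem bergmanProj_eq_self (B : EigenBasis h H k) {u : PowSection L k} (hu : u ∈ holSections m L k) :
    bergmanProj h k u = u := by
  have hex : ∃ v ∈ holSections m L k, ∀ t ∈ holSections m L k,
      l2Inner h k u t = l2Inner h k v t := ⟨u, hu, fun _ _ => rfl⟩
  rw [bergmanProj, dif_pos hex]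
  exact (B.eq_of_l2Inner_eq hu hex.choose_spec.1 hex.choose_spec.2).symm

variable [IsManifold 𝓘(ℂ, Fin m → ℂ) ω M] [ContMDiffVectorBundle ω ℂ L 𝓘(ℂ, Fin m → ℂ)]

/-- At a critical point of a Hamiltonian generating a holomorphic action, an eigensection with
eigenvalue different from the critical value vanishes. -/
theorem normSqAt_sec_eq_zero (hpos : IsPositive h)
    (hH : ContMDiff 𝓘(ℝ, Fin m → ℂ) 𝓘(ℝ, ℝ) ∞ H) (haction : GeneratesHolomorphicAction h H)
    (hk : k ≠ 0) {z : M} (hz : mfderiv 𝓘(ℝ, Fin m → ℂ) 𝓘(ℝ, ℝ) H z = 0) {j : Fin B.N}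
    (hj : B.eigenvalue j ≠ H z) : normSqAt h k (B.sec j) z = 0 := by
  have h1 : toeplitz h H k (B.sec j) = prequantum h H k (B.sec j) :=
    B.bergmanProj_eq_self (prequantum_mem_holSections hpos hH haction hk (B.sec_mem j))
  have h2 := congrFun (h1.symm.trans (B.eigen j)) z
  have h3 : chernDeriv h k (hamiltonianField h H) (B.sec j) z = 0 := by
    rw [chernDeriv, hamiltonianField_eq_zero hpos hz]
    have h4 : chernForm h (trivializationAt ℂ L z) z 0 = 0 := by
      have h5 : complexJ z (0 : TangentSpace 𝓘(ℝ, Fin m → ℂ) z) = 0 :=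
        smul_zero (A := Fin m → ℂ) Complex.I
      refine (chernForm_eq h _ (a := 0) (b := 0) ?_ ?_).trans (by simp)
      · rw [h5, map_zero]; rfl
      · rw [map_zero]; rfl
    simp only [map_zero, h4, mul_zero]
    erw [add_zero]
    exact zero_smul ℂ _
  simp only [prequantum, h3, smul_zero, add_zero, Pi.smul_apply] at h2
  have h6 := congrArg (powCoord k (trivializationAt ℂ L z) z) h2
  rw [map_smul, map_smul, smul_eq_mul, smul_eq_mul] at h6
  -- With the connection term gone, `h6` says H(z) f = μ f for the coordinate f of the section at z.
  have h7 : powCoord k (trivializationAt ℂ L z) z (B.sec j z) = 0 := by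
    by_contra h0
    exact hj (Complex.ofReal_injective (mul_right_cancel₀ h0 h6)).symm
  simp [normSqAt, powInner, h7]

end EigenBasis

end Spectrum

end KahlerQuantization

/-! ### The main theorem -/

open KahlerQuantization in
theorem mainTheorem5 {m : ℕ} {M : Type*} [TopologicalSpace M] [CompactSpace M] [T2Space M]
    [ChartedSpace (Fin m → ℂ) M] [IsManifold 𝓘(ℂ, Fin m → ℂ) ω M]
    [MeasurableSpace M] [BorelSpace M]
    {L : M → Type*} [TopologicalSpace (TotalSpace ℂ L)]
    [∀ x, AddCommGroup (L x)] [∀ x, Module ℂ (L x)] [∀ x, TopologicalSpace (L x)]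
    [FiberBundle ℂ L] [VectorBundle ℂ ℂ L]
    [ContMDiffVectorBundle ω ℂ L 𝓘(ℂ, Fin m → ℂ)]
    (h : HermitianMetric m L) (hpos : IsPositive h)
    (H : M → ℝ) (hH : ContMDiff 𝓘(ℝ, Fin m → ℂ) 𝓘(ℝ, ℝ) ∞ H)
    (haction : GeneratesHolomorphicAction h H)
    (z_c : M) (hcrit : mfderiv 𝓘(ℝ, Fin m → ℂ) 𝓘(ℝ, ℝ) H z_c = 0) :
    (∀ (k : ℕ+) (B : EigenBasis h H k),
      B.spectralMeasure z_c = ENNReal.ofReal (B.density z_c) • Measure.dirac (H z_c) ∧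
      (B.density z_c ≠ 0 → B.normalizedSpectralMeasure z_c = Measure.dirac (H z_c)) ∧
      ∀ I : Set ℝ,
        (H z_c ∈ I → B.partialDensity I z_c = B.density z_c) ∧
        (H z_c ∉ I → B.partialDensity I z_c = 0)) ∧
    ∀ (B : ∀ k : ℕ+, EigenBasis h H k) (I : Set ℝ),
      (H z_c ∈ I →
        Tendsto (fun k : ℕ+ => (B k).partialDensity I z_c / (B k).density z_c)
          (atTop ⊓ 𝓟 {k : ℕ+ | (B k).density z_c ≠ 0}) (𝓝 1)) ∧
      (H z_c ∉ I →
        Tendsto (fun k : ℕ+ => (B k).partialDensity I z_c / (B k).density z_c) atTop (𝓝 0)) := by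
  classical
  have hvan : ∀ (k : ℕ+) (B : EigenBasis h H k) (j : Fin B.N), B.eigenvalue j ≠ H z_c →
      normSqAt h k (B.sec j) z_c = 0 := fun k B j hj =>
    B.normSqAt_sec_eq_zero hpos hH haction k.ne_zero hcrit hj
  have hpartial : ∀ (k : ℕ+) (B : EigenBasis h H k) (I : Set ℝ),
      (H z_c ∈ I → B.partialDensity I z_c = B.density z_c) ∧
      (H z_c ∉ I → B.partialDensity I z_c = 0) := by
    intro k B I
    refine ⟨fun hI => ?_, fun hI => ?_⟩
    -- The discarded terms have eigenvalues outside I, hence different from E, and so vanish.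
    · refine Finset.sum_subset (Finset.filter_subset _ _) fun j _ hj => hvan k B j fun hE => hj ?_
      exact Finset.mem_filter.2 ⟨Finset.mem_univ _, hE ▸ hI⟩
    · refine Finset.sum_eq_zero fun j hj => hvan k B j fun hE => hI ?_
      exact hE ▸ (Finset.mem_filter.1 hj).2
  have hmeas : ∀ (k : ℕ+) (B : EigenBasis h H k),
      B.spectralMeasure z_c = ENNReal.ofReal (B.density z_c) • Measure.dirac (H z_c) := by
    intro k B
    rw [EigenBasis.density, ENNReal.ofReal_sum_of_nonneg fun j _ => normSqAt_nonneg h k _ z_c,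
      Finset.sum_smul]
    refine Finset.sum_congr rfl fun j _ => ?_
    by_cases hj : B.eigenvalue j = H z_c
    · rw [hj]
    · rw [hvan k B j hj, ENNReal.ofReal_zero, zero_smul, zero_smul]
  refine ⟨fun k B => ⟨hmeas k B, fun hd => ?_, hpartial k B⟩, fun B I => ⟨fun hI => ?_, fun hI => ?_⟩⟩
  · have hd0 : 0 < B.density z_c :=
      lt_of_le_of_ne (Finset.sum_nonneg fun j _ => normSqAt_nonneg h k _ z_c) hd.symm
    rw [EigenBasis.normalizedSpectralMeasure, hmeas k B, Measure.smul_apply, measure_univ,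
      smul_eq_mul, mul_one, smul_smul,
      ENNReal.inv_mul_cancel (ENNReal.ofReal_pos.2 hd0).ne' ENNReal.ofReal_ne_top, one_smul]
  · refine tendsto_const_nhds.congr' ?_
    filter_upwards [mem_inf_of_right (mem_principal_self _)] with k hk
    rw [(hpartial k (B k) I).1 hI, div_self hk]
  -- The numerator is 0 for every k, so the quotient is 0 even where the density vanishes (0/0 = 0),
  -- and no restriction on k is needed.
  · refine tendsto_const_nhds.congr fun k => ?_
    rw [(hpartial k (B k) I).2 hI, zero_div]
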